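/- **Setting.** Let $K$ be a field of characteristic $0$ (for example $\mathbb{C}$, or $\mathbb{C}(a)$, so that the parameter $a$ may be an indeterminate), and let $a,b,c,d\in K$. There are two cases, Racah (R) and $q$-Racah ($q$R). In the second case $q\in K$ is nonzero and not a root of unity, $a,b,c,d\neq0$, and every function of $x$ is a rational function of $q^x$, where $q^x$ ranges over $K\setminus\{0\}$; in the first case $x$ ranges over $K$. Write $\lambda=(a,b,c,d)$ (R), $q^\lambda=(a,b,c,d)$ ($q$R); $\delta=(1,1,1,1)$; $\mathfrak t(\lambda)=(\lambda_4-\lambda_1+1,\lambda_4-\lambda_2+1,\lambda_3,\lambda_4)$; $(y)_k=\prod_{i<k}(y+i)$, $(y;q)_k=\prod_{i<k}(1-yq^i)$, and a comma inside such a symbol denotes a product. In each pair below the first formula is for R and the second for $q$R. - $\eta(x;\lambda)=x(x+d)$; $(q^{-x}-1)(1-dq^x)$. $\tilde d=a+b+c-d-1$; $abcd^{-1}q^{-1}$. - $\check P_n(x;\lambda)={}_4F_3\bigl({-n,\,n+\tilde d,\,-x,\,x+d\atop a,\,b,\,c}\big|1\bigr)$; ${}_4\phi_3\bigl({q^{-n},\,\tilde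 dq^n,\,q^{-x},\,dq^x\atop a,\,b,\,c}\big|q;q\bigr)$. $\check\xi_v(x;\lambda)=\check P_v(x;\mathfrak t(\lambda))$. - $A_n=\frac{(n+a)(n+b)(n+c)(n+\tilde d)}{(2n+\tilde d)(2n+1+\tilde d)}$; $\frac{(1-aq^n)(1-bq^n)(1-cq^n)(1-\tilde dq^n)}{(1-\tilde dq^{2n})(1-\tilde dq^{2n+1})}$, except that $A_{-1}=0$. - $C_n=\frac{(n+\tilde d-a)(n+\tilde d-b)(n+\tilde d-c)n}{(2n-1+\tilde d)(2n+\tilde d)}$; $d\,\frac{(1-a^{-1}\tilde dq^n)(1-b^{-1}\tilde dq^n)(1-c^{-1}\tilde dq^n)(1-q^n)}{(1-\tilde dq^{2n-1})(1-\tilde dq^{2n})}$, with $C_0=0$. $B_n=-A_n-C_n$. - $\mathcal E_n=n(n+\tilde d)$; $(q^{-n}-1)(1-\tilde dq^n)$. $\tilde{\mathcal E}_v=-(c+v)(\tilde d-c-v)$; $-(1-cq^v)(1-c^{-1}\tilde dq^{-v})$. $\alpha=1$; $abd^{-1}q^{-1}$. - $B'(x)=-\frac{(x+d-a+1)(x+d-b+1)(x+c)(x+d)}{(2x+d)(2x+1+d)}$;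 $-\frac{(1-a^{-1}dq^{x+1})(1-b^{-1}dq^{x+1})(1-cq^x)(1-dq^x)}{(1-dq^{2x})(1-dq^{2x+1})}$. - $\varphi_m(x)=\prod_{1\le j<k\le m}\frac{\eta(x+k-1)-\eta(x+j-1)}{\eta(k-j)}$. - For $1\le j\le M+1$ and $x_j=x+j-1$: $r_j(x_j)=\frac{(x+a,\,x+b)_{j-1}(x+d-a+j,\,x+d-b+j)_{M+1-j}}{(d-a+1,\,d-b+1)_M}$; $\frac{(aq^x,bq^x;q)_{j-1}(a^{-1}dq^{x+j},b^{-1}dq^{x+j};q)_{M+1-j}}{(abd^{-1}q^{-1})^{j-1}q^{Mx}(a^{-1}dq,b^{-1}dq;q)_M}$. Let $M\ge0$ and $\mathcal D=\{d_1<\dots<d_M\}$ with integers $d_j\ge1$. Put $\mathcal C_{\mathcal D}=\frac1{\varphi_M(0)}\prod_{1\le j<k\le M}\frac{\tilde{\mathcal E}_{d_j}-\tilde{\mathcal E}_{d_k}}{\alpha B'(j-1)}$ and $\mathcal C_{\mathcal D,n}=(-1)^M\mathcal C_{\mathcal D}\,\frac{\varphi_M(0)}{\varphi_{M+1}(0)}\prod_{j=1}^M\frac{\mathcal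 E_n-\tilde{\mathcal E}_{d_j}}{\alpha B'(j-1)}$. The $M$-indexed ($q$-)Racah polynomial $P_{\mathcal D,n}(\eta)\in K[\eta]$, $n\ge0$, is given by $$P_{\mathcal D,n}\bigl(\eta(x;\lambda+M\delta)\bigr)=\mathcal C_{\mathcal D,n}^{-1}\varphi_{M+1}(x)^{-1}\det\Bigl(\check\xi_{d_1}(x_j),\dots,\check\xi_{d_M}(x_j),\ r_j(x_j)\check P_n(x_j)\Bigr)_{1\le j\le M+1}$$ for all $x$ with $\varphi_{M+1}(x)\ne0$, and $P_{\mathcal D,n}=0$ for $n<0$. For integers $n,k$ and $s\ge-1$ define $\check R^{[s]}_{n,k}(x)=0$ if $|k|>s+1$ or $n+k<0$; $\check R^{[-1]}_{n,0}(x)=1$ for $n\ge0$; and otherwise, for $s\ge0$, $$\check R^{[s]}_{n,k}(x)=A_n\check R^{[s-1]}_{n+1,k-1}(x)+\bigl(B_n-\eta(x+s)\bigr)\check R^{[s-1]}_{n,k}(x)+C_n\check R^{[s-1]}_{n-1,k+1}(x).$$ **Theorem.** Let $n\in\mathbb Z$, and assume that no denominator occurring in the above formulas vanishes, for the indices that enter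 the relations below; explicitly, with $[y]_k=(y)_k$ (R), $(y;q)_k$ ($q$R): $[a]_m,[b]_m,[c]_m\ne0$ for $0\le m\le n+M+1$; $[t_1]_{d_j},[t_2]_{d_j},[c]_{d_j}\neq0$ for all $j$, where $t_1,t_2=d-a+1,\,d-b+1$ (R), $a^{-1}dq,\,b^{-1}dq$ ($q$R); $[d]_{2M}\ne0$; $[\tilde d]_{2m+2}\ne0$ for $0\le m\le n+M$; $\tilde{\mathcal E}_{d_j}\neq\tilde{\mathcal E}_{d_k}$ for $j\ne k$; $\mathcal E_m\ne\tilde{\mathcal E}_{d_j}$ for all $j$ and all $m\ge0$ with $|m-n|\le M+1$. (This allows $a$ to be an indeterminate, and also $a=-N$, resp. $a=q^{-N}$, with an integer $N\ge n+M+1$.) Then: 1. For $m\geq 0$ with $|m-n|\le M+1$ there is exactly one polynomial $P_{\mathcal D,m}(\eta)$ as above. For $|k|\le M+1$ there is exactly one polynomial $R^{[M]}_{n,k}(\eta)\in K[\eta]$ with $R^{[M]}_{n,k}(\eta(x;\lambda+M\delta))=\check R^{[M]}_{n,k}(x)$ for all $x$. Its degree is at most $M+1-|k|$, and it is exactly $M+1-|k|$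 if $n\ge0$, $n+k\ge0$ and (when $k<0$) $C_{n+k+1},\dots,C_n$ are nonzero. 2. The multi-indexed ($q$-)Racah polynomials satisfy the $3+2M$ term recurrence relations $$\sum_{k=-M-1}^{M+1}\mathcal C_{\mathcal D,n+k}\,R^{[M]}_{n,k}(\eta)\,P_{\mathcal D,n+k}(\eta)=0,$$ or, equivalently, $$\sum_{k=-M-1}^{M+1}\ \prod_{j=1}^M\frac{\mathcal E_{n+k}-\tilde{\mathcal E}_{d_j}}{\mathcal E_n-\tilde{\mathcal E}_{d_j}}\cdot R^{[M]}_{n,k}(\eta)\,P_{\mathcal D,n+k}(\eta)=0.$$ (For $n<0$ all $R^{[M]}_{n,k}$ vanish and both relations are trivial.) -/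

import Mathlib

open Polynomial

namespace MultiRacah

/-- The Racah case, or the `q`-Racah case with base `q`. -/
inductive Kind (K : Type*) where
  | racah : Kind K
  | qRacah (q : K) : Kind K

/-- The parameters of a (`q`-)Racah system: `lam = (a, b, c, d)` in the Racah case and
`q ^ lam = (a, b, c, d)` in the `q`-Racah case.

A point `x` is represented by `u = x` in the Racah case and by `u = q ^ x` in the `q`-Racah case,
so that every function of `x` below is a function of `u`, rational in `u` and in the parameters. -/
structure Params (K : Type*) where
  kind : Kind K
  a : K
  b : K
  c : K
  d : K

variable {K : Type*} [Field K]

/-- `(y)_k = y (y + 1) ⋯ (y + k - 1)`, resp. `(y ; q)_k = (1 - y) (1 - y q) ⋯ (1 - y q ^ (k - 1))`. -/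
def Kind.poch (κ : Kind K) (y : K) (k : ℕ) : K :=
  match κ with
  | .racah => ∏ i ∈ Finset.range k, (y + (i : K))
  | .qRacah q => ∏ i ∈ Finset.range k, (1 - y * q ^ i)

namespace Params

/-- `u` represents a point: no condition for `u = x`, and `u ≠ 0` for `u = q ^ x`. -/
def IsPoint (p : Params K) (u : K) : Prop :=
  match p.kind with
  | .racah => True
  | .qRacah _ => u ≠ 0

/-- The point `x = 0`. -/
def origin (p : Params K) : K :=
  match p.kind with
  | .racah => 0
  | .qRacah _ => 1

/-- The point `x + j`, where `u` is the point `x`. -/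
def adv (p : Params K) (j : ℕ) (u : K) : K :=
  match p.kind with
  | .racah => u + (j : K)
  | .qRacah q => u * q ^ j

/-- The parameters `lam + s • (1, 1, 1, 1)`. -/
def shift (p : Params K) (s : ℕ) : Params K :=
  match p.kind with
  | .racah => ⟨p.kind, p.a + (s : K), p.b + (s : K), p.c + (s : K), p.d + (s : K)⟩
  | .qRacah q => ⟨p.kind, p.a * q ^ s, p.b * q ^ s, p.c * q ^ s, p.d * q ^ s⟩

/-- The twist `(lam₄ - lam₁ + 1, lam₄ - lam₂ + 1, lam₃, lam₄)` of the parameters. -/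
def twist (p : Params K) : Params K :=
  match p.kind with
  | .racah => ⟨p.kind, p.d - p.a + 1, p.d - p.b + 1, p.c, p.d⟩
  | .qRacah q => ⟨p.kind, p.a⁻¹ * p.d * q, p.b⁻¹ * p.d * q, p.c, p.d⟩

/-- The sinusoidal coordinate `η(x)`: `x (x + d)`, resp. `(q ^ (-x) - 1) (1 - d q ^ x)`. -/
def eta (p : Params K) (u : K) : K :=
  match p.kind with
  | .racah => u * (u + p.d)
  | .qRacah _ => (u⁻¹ - 1) * (1 - p.d * u)

/-- `d̃`: `a + b + c - d - 1`, resp. `a b c d⁻¹ q⁻¹`. -/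
def dt (p : Params K) : K :=
  match p.kind with
  | .racah => p.a + p.b + p.c - p.d - 1
  | .qRacah q => p.a * p.b * p.c * p.d⁻¹ * q⁻¹

/-- The (`q`-)Racah polynomial as a function of the point:
`₄F₃(-n, n + d̃, -x, x + d ; a, b, c | 1)`, resp.
`₄φ₃(q ^ (-n), d̃ q ^ n, q ^ (-x), d q ^ x ; a, b, c | q ; q)`. -/
def cP (p : Params K) (n : ℕ) (u : K) : K :=
  match p.kind with
  | .racah => ∑ k ∈ Finset.range (n + 1),
      (p.kind.poch (-(n : K)) k * p.kind.poch ((n : K) + p.dt) k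
        * p.kind.poch (-u) k * p.kind.poch (u + p.d) k)
      / (p.kind.poch p.a k * p.kind.poch p.b k * p.kind.poch p.c k * p.kind.poch 1 k)
  | .qRacah q => ∑ k ∈ Finset.range (n + 1),
      (p.kind.poch ((q ^ n)⁻¹) k * p.kind.poch (p.dt * q ^ n) k
        * p.kind.poch u⁻¹ k * p.kind.poch (p.d * u) k)
      / (p.kind.poch p.a k * p.kind.poch p.b k * p.kind.poch p.c k * p.kind.poch q k) * q ^ k

/-- The virtual state polynomial as a function of the point. -/
def cXi (p : Params K) (v : ℕ) (u : K) : K := p.twist.cP v u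

/-- The coefficient `A_n` of the three term recurrence relation, with `A_{-1} = 0`. -/
def A (p : Params K) (n : ℤ) : K :=
  if n = -1 then 0 else
  match p.kind with
  | .racah => (((n : K) + p.a) * ((n : K) + p.b) * ((n : K) + p.c) * ((n : K) + p.dt))
      / ((2 * (n : K) + p.dt) * (2 * (n : K) + 1 + p.dt))
  | .qRacah q => ((1 - p.a * q ^ n) * (1 - p.b * q ^ n) * (1 - p.c * q ^ n) * (1 - p.dt * q ^ n))
      / ((1 - p.dt * q ^ (2 * n)) * (1 - p.dt * q ^ (2 * n + 1)))

/-- The coefficient `C_n` of the three term recurrence relation. -/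
def C (p : Params K) (n : ℤ) : K :=
  match p.kind with
  | .racah => (((n : K) + p.dt - p.a) * ((n : K) + p.dt - p.b) * ((n : K) + p.dt - p.c) * (n : K))
      / ((2 * (n : K) - 1 + p.dt) * (2 * (n : K) + p.dt))
  | .qRacah q => p.d * ((1 - p.a⁻¹ * p.dt * q ^ n) * (1 - p.b⁻¹ * p.dt * q ^ n)
        * (1 - p.c⁻¹ * p.dt * q ^ n) * (1 - q ^ n))
      / ((1 - p.dt * q ^ (2 * n - 1)) * (1 - p.dt * q ^ (2 * n)))

/-- The coefficient `B_n` of the three term recurrence relation. -/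
def B (p : Params K) (n : ℤ) : K := -p.A n - p.C n

/-- The energy `E_n`: `n (n + d̃)`, resp. `(q ^ (-n) - 1) (1 - d̃ q ^ n)`. -/
def energy (p : Params K) (n : ℤ) : K :=
  match p.kind with
  | .racah => (n : K) * ((n : K) + p.dt)
  | .qRacah q => (q ^ (-n) - 1) * (1 - p.dt * q ^ n)

/-- The virtual state energy. -/
def venergy (p : Params K) (v : ℕ) : K :=
  match p.kind with
  | .racah => -((p.c + (v : K)) * (p.dt - p.c - (v : K)))
  | .qRacah q => -((1 - p.c * q ^ v) * (1 - p.c⁻¹ * p.dt * (q ^ v)⁻¹))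

/-- The potential function `B(x)`. -/
def potB (p : Params K) (u : K) : K :=
  match p.kind with
  | .racah => -((u + p.a) * (u + p.b) * (u + p.c) * (u + p.d))
      / ((2 * u + p.d) * (2 * u + 1 + p.d))
  | .qRacah q => -((1 - p.a * u) * (1 - p.b * u) * (1 - p.c * u) * (1 - p.d * u))
      / ((1 - p.d * u ^ 2) * (1 - p.d * q * u ^ 2))

/-- The potential function `B'(x)`. -/
def potB' (p : Params K) (u : K) : K := p.twist.potB u

/-- `α`: `1`, resp. `a b d⁻¹ q⁻¹`. -/
def alpha (p : Params K) : K :=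
  match p.kind with
  | .racah => 1
  | .qRacah q => p.a * p.b * p.d⁻¹ * q⁻¹

/-- The auxiliary function
`φ_M(x) = ∏_{1 ≤ j < k ≤ M} (η(x + k - 1) - η(x + j - 1)) / η(k - j)`. -/
def phi (p : Params K) (M : ℕ) (u : K) : K :=
  ∏ k ∈ Finset.range M, ∏ j ∈ Finset.range k,
    (p.eta (p.adv k u) - p.eta (p.adv j u)) / p.eta (p.adv (k - j) p.origin)

/-- The function `r_{i+1}(x_{i+1}; lam, M)`, `0 ≤ i ≤ M`, of the point `x`
(where `x_{i+1} = x + i`). -/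
def r (p : Params K) (M i : ℕ) (u : K) : K :=
  match p.kind with
  | .racah =>
      (p.kind.poch (u + p.a) i * p.kind.poch (u + p.b) i
        * p.kind.poch (u + p.d - p.a + (i : K) + 1) (M - i)
        * p.kind.poch (u + p.d - p.b + (i : K) + 1) (M - i))
      / (p.kind.poch (p.d - p.a + 1) M * p.kind.poch (p.d - p.b + 1) M)
  | .qRacah q =>
      (p.kind.poch (p.a * u) i * p.kind.poch (p.b * u) i
        * p.kind.poch (p.a⁻¹ * p.d * u * q ^ (i + 1)) (M - i)
        * p.kind.poch (p.b⁻¹ * p.d * u * q ^ (i + 1)) (M - i))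
      / ((p.a * p.b * p.d⁻¹ * q⁻¹) ^ i * u ^ M
        * (p.kind.poch (p.a⁻¹ * p.d * q) M * p.kind.poch (p.b⁻¹ * p.d * q) M))

section MultiIndexed

variable {M : ℕ}

/-- The normalization constant `C_D` of the denominator polynomial. -/
def constD (p : Params K) (D : Fin M → ℕ) : K :=
  (p.phi M p.origin)⁻¹ * ∏ k : Fin M, ∏ j ∈ Finset.Iio k,
    (p.venergy (D j) - p.venergy (D k)) / (p.alpha * p.potB' (p.adv (j : ℕ) p.origin))

/-- The constant `d̃_{D,n} ^ 2`. -/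
def dtSq (p : Params K) (D : Fin M → ℕ) (n : ℤ) : K :=
  p.phi M p.origin / p.phi (M + 1) p.origin * ∏ j : Fin M,
    (p.energy n - p.venergy (D j)) / (p.alpha * p.potB' (p.adv (j : ℕ) p.origin))

/-- The normalization constant `C_{D,n}`. -/
def constDn (p : Params K) (D : Fin M → ℕ) (n : ℤ) : K :=
  (-1) ^ M * p.constD D * p.dtSq D n

/-- The multi-indexed (`q`-)Racah polynomial as a function of the point: the determinant of the
matrix with rows `(ξ_{d_1}(x_i), …, ξ_{d_M}(x_i), r_i(x_i) P_n(x_i))`, divided by `C_{D,n}` and by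
`φ_{M+1}(x)`. -/
def cPD (p : Params K) (D : Fin M → ℕ) (n : ℕ) (u : K) : K :=
  (p.constDn D n)⁻¹ * (p.phi (M + 1) u)⁻¹ *
    Matrix.det (Matrix.of fun i j : Fin (M + 1) =>
      Fin.snoc (α := fun _ => K) (fun k : Fin M => p.cXi (D k) (p.adv (i : ℕ) u))
        (p.r M (i : ℕ) u * p.cP n (p.adv (i : ℕ) u)) j)

/-- `Q(η(x; lam + M δ))` is the multi-indexed (`q`-)Racah polynomial of index `n`, for all points
`x` at which the determinant formula makes sense. -/
def IsPD (p : Params K) (D : Fin M → ℕ) (n : ℕ) (Q : K[X]) : Prop :=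
  ∀ u : K, p.IsPoint u → p.phi (M + 1) u ≠ 0 → Q.eval ((p.shift M).eta u) = p.cPD D n u

/-- The multi-indexed (`q`-)Racah polynomial `P_{D,n}(η)`, with `P_{D,n} = 0` for `n < 0`. -/
noncomputable def PD (p : Params K) (D : Fin M → ℕ) (n : ℤ) : K[X] :=
  if n < 0 then 0 else Classical.epsilon (p.IsPD D n.toNat)

end MultiIndexed

/-- `cR p t n k` is the coefficient `R^{[t-1]}_{n,k}` as a function of the point, `t ≥ 0`. -/
def cR (p : Params K) : ℕ → ℤ → ℤ → K → K
  | 0, n, k, _ => if k = 0 ∧ 0 ≤ n then 1 else 0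
  | t + 1, n, k, u =>
      if ((t : ℤ) + 1 < |k|) ∨ n + k < 0 then 0
      else p.A n * p.cR t (n + 1) (k - 1) u
        + (p.B n - p.eta (p.adv t u)) * p.cR t n k u
        + p.C n * p.cR t (n - 1) (k + 1) u

/-- `Q(η(x; lam + s δ)) = R^{[s]}_{n,k}(x)` for all points `x`. -/
def IsR (p : Params K) (s : ℕ) (n k : ℤ) (Q : K[X]) : Prop :=
  ∀ u : K, p.IsPoint u → Q.eval ((p.shift s).eta u) = p.cR (s + 1) n k u

/-- The coefficient `R^{[s]}_{n,k}(η)` as a polynomial in `η`. -/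
noncomputable def R (p : Params K) (s : ℕ) (n k : ℤ) : K[X] :=
  Classical.epsilon (p.IsR s n k)

/-- None of the denominators in the quantities entering the recurrence relation at `n` vanishes. -/
structure DenomsNeZero (p : Params K) {M : ℕ} (D : Fin M → ℕ) (n : ℤ) : Prop where
  /-- `q ≠ 0` is not a root of unity, and the parameters `q ^ lam` are nonzero. -/
  base : match p.kind with
    | .racah => True
    | .qRacah q => q ≠ 0 ∧ (∀ k : ℕ, 1 ≤ k → q ^ k ≠ 1) ∧
        p.a ≠ 0 ∧ p.b ≠ 0 ∧ p.c ≠ 0 ∧ p.d ≠ 0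
  /-- Denominators of `P_m`, `m ≤ n + M + 1`. -/
  racah : ∀ m : ℕ, (m : ℤ) ≤ n + M + 1 →
    p.kind.poch p.a m ≠ 0 ∧ p.kind.poch p.b m ≠ 0 ∧ p.kind.poch p.c m ≠ 0
  /-- Denominators of the virtual state polynomials, of `r_j`, and of `1 / B'(j - 1)`. -/
  virtual : ∀ j : Fin M, p.kind.poch p.twist.a (D j) ≠ 0 ∧ p.kind.poch p.twist.b (D j) ≠ 0 ∧
    p.kind.poch p.twist.c (D j) ≠ 0
  /-- Denominators of `φ_{M+1}`, `1 / φ_{M+1}(0)`, `B'(j - 1)` and `1 / B'(j - 1)`. -/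
  point : p.kind.poch p.d (2 * M) ≠ 0
  /-- Denominators of `A_m`, `B_m`, `C_m`, `m ≤ n + M`. -/
  recur : ∀ m : ℕ, (m : ℤ) ≤ n + M → p.kind.poch p.dt (2 * m + 2) ≠ 0
  /-- `C_D ≠ 0`. -/
  venergy_inj : ∀ j k : Fin M, j ≠ k → p.venergy (D j) ≠ p.venergy (D k)
  /-- `C_{D,m} ≠ 0` for `m = n + k`, `|k| ≤ M + 1`. -/
  energy_ne : ∀ m : ℕ, |(m : ℤ) - n| ≤ M + 1 → ∀ j : Fin M, p.energy m ≠ p.venergy (D j)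

end Params

end MultiRacah

/-! Let J be the tridiagonal matrix with row n equal to (C_n, B_n, A_n). The three term recurrence
`eta_mul_cP` says that (P_m(y))_m is an eigenvector of J with eigenvalue η(y). By `cR_eq_bandCoeff`,
R^{[M]}_{n,k}(x) is the entry (n, n+k) of the product of the commuting matrices J - η(x+i), 0 ≤ i ≤
M. This product annihilates the eigenvectors at y = x, …, x+M (`sum_cR_mul_cP`). Expanding the
defining determinant along its last column (`det_detMatrix`) shows that C_{D,m} φ_{M+1}(x) P_{D,m}
is a combination of P_m(x), …, P_m(x+M) with weights that do not depend on m, so the recurrence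
follows. The second form follows because C_{D,m} depends on m only through ∏_j (E_m - Ẽ_{d_j})
(`exists_constDn_eq`).

Polynomiality comes from the reflection x ↦ -x-d-M, which fixes η(x; λ+Mδ). A function generated by
the basic coordinate and its reflection is a polynomial in η(x; λ+Mδ) as soon as it is invariant
(`exists_eval_of_invariant`). For R the reflection merely permutes η(x), …, η(x+M), and hence the
commuting factors. For P_D the determinant must first be divided by the Vandermonde product of the
η(x+i). The factors r_i are the values at η(x+i) of a single interpolation polynomial, because their
divided differences have closed product form (`exists_interpolant_prod`). The determinant is
therefore a generalized alternant, divisible by the Vandermonde product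
(`vandermonde_dvd_det_eval`), and both change by the same sign under the reflection.

Uniqueness holds because only finitely many points are excluded and η has finite fibres. The degree
of R is read off at infinity (`hasSymbol_bandCoeff`): the top coefficient is a product of entries
A_l or C_l times a coefficient of ∏_i (X - κ_i), with κ_i the leading coefficient of η(x+i). That
coefficient is, up to nonzero factors, a binomial or q-binomial coefficient. -/

namespace MultiRacah

/-! ### Generalized alternants and division-free Newton interpolation over a commutative ring. -/

section Alternant

variable {R : Type*} [CommRing R]

/-- A generalized alternant is divisible by the Vandermonde product. -/
theorem vandermonde_dvd_det_eval : ∀ {n : ℕ} (v : Fin n → R) (P : Fin n → R[X]),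
    (∏ i, ∏ j ∈ Finset.Ioi i, (v j - v i)) ∣ Matrix.det (Matrix.of fun i j => (P j).eval (v i))
  | 0, v, P => by simp
  | n + 1, v, P => by
    have hq : ∀ j, ∃ Q : R[X], P j - Polynomial.C ((P j).eval (v 0))
        = (X - Polynomial.C (v 0)) * Q := fun j => Polynomial.X_sub_C_dvd_sub_C_eval
    choose Q hQ using hq
    have hQ' : ∀ j i, (P j).eval (v i) = (v i - v 0) * (Q j).eval (v i) + (P j).eval (v 0) := by
      intro j i
      have := congrArg (Polynomial.eval (v i)) (hQ j)
      simp only [eval_sub, eval_C, eval_mul, eval_X] at this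
      rw [← this]; ring
    -- Subtracting row 0 from the other rows leaves the factor `v i - v 0` in each of them. After
    -- expansion along row 0 every minor is such a product times an alternant in the quotients `Q`,
    -- on one node fewer.
    let B : Matrix (Fin (n + 1)) (Fin (n + 1)) R := Matrix.of fun i j =>
      Fin.cases (motive := fun _ => R) ((P j).eval (v 0))
        (fun i' => (v i'.succ - v 0) * (Q j).eval (v i'.succ)) i
    have hB : Matrix.det (Matrix.of fun i j => (P j).eval (v i)) = B.det := by
      refine Matrix.det_eq_of_forall_row_eq_smul_add_const
        (Fin.cases (motive := fun _ => R) 0 (fun _ => 1)) 0 rfl ?_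
      intro i j
      refine Fin.cases ?_ (fun i' => ?_) i
      · simp [B]
      · simp only [Matrix.of_apply, B, Fin.cases_succ, Fin.cases_zero]
        rw [hQ' j i'.succ]; ring
    rw [hB, Matrix.det_succ_row_zero]
    refine Finset.dvd_sum fun j _ => Dvd.dvd.mul_left ?_ _
    have hsub : B.submatrix Fin.succ j.succAbove = Matrix.of fun i j' =>
        (v (Fin.succ i) - v 0) * (Matrix.of fun (i : Fin n) (j' : Fin n) =>
          (Q (j.succAbove j')).eval (v i.succ)) i j' := by
      ext i j'
      simp [B]
    rw [hsub, Matrix.det_mul_column, Fin.prod_univ_succ, Fin.prod_Ioi_zero]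
    refine mul_dvd_mul dvd_rfl ?_
    have := vandermonde_dvd_det_eval (fun i => v (Fin.succ i)) (fun j' => Q (j.succAbove j'))
    simpa [Fin.prod_Ioi_succ] using this

/-- The Newton interpolation polynomial on the nodes `v i, …, v (i + m)` with divided
differences `g`. -/
noncomputable def newtonPoly (v : ℕ → R) (g : ℕ → ℕ → R) : ℕ → ℕ → R[X]
  | 0, i => Polynomial.C (g 0 i)
  | m + 1, i => newtonPoly v g m i
      + Polynomial.C (g (m + 1) i) * ∏ l ∈ Finset.range (m + 1), (X - Polynomial.C (v (i + l)))

variable {v : ℕ → R} {g : ℕ → ℕ → R} {M : ℕ}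

/-- Newton's form on `v i, …, v (i + m + 1)` can also be reached by adjoining the first node last.
Since `h` is stated without division, the nodes may coincide or differ by zero divisors. -/
theorem newtonPoly_succ_left
    (h : ∀ j i, i + j + 1 ≤ M → g j (i + 1) - g j i = (v (i + j + 1) - v i) * g (j + 1) i) :
    ∀ m i, i + m + 1 ≤ M → newtonPoly v g (m + 1) i = newtonPoly v g m (i + 1)
      + Polynomial.C (g (m + 1) i)
        * ∏ l ∈ Finset.range (m + 1), (X - Polynomial.C (v (i + 1 + l)))
  | 0, i, hi => by
    have := congrArg (Polynomial.C (R := R)) (h 0 i hi)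
    simp only [map_sub, map_mul, add_zero] at this
    simp only [newtonPoly, zero_add, Finset.prod_range_one, add_zero]
    linear_combination -this
  | m + 1, i, hi => by
    have := congrArg (Polynomial.C (R := R)) (h (m + 1) i (by omega))
    simp only [map_sub, map_mul] at this
    have h1 := newtonPoly_succ_left h m i (by omega)
    have h2 : newtonPoly v g (m + 1) (i + 1) = newtonPoly v g m (i + 1)
      + Polynomial.C (g (m + 1) (i + 1))
        * ∏ l ∈ Finset.range (m + 1), (X - Polynomial.C (v (i + 1 + l))) := rfl
    rw [newtonPoly, h1, h2, Finset.prod_range_succ' _ (m + 1), Finset.prod_range_succ _ (m + 1)]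
    have h3 : ∏ k ∈ Finset.range (m + 1), (X - Polynomial.C (v (i + (k + 1))))
        = ∏ l ∈ Finset.range (m + 1), (X - Polynomial.C (v (i + 1 + l))) :=
      Finset.prod_congr rfl fun l _ => by rw [show i + (l + 1) = i + 1 + l by ring]
    rw [h3, show i + 1 + (m + 1) = i + (m + 1) + 1 by ring, add_zero]
    linear_combination
      -(∏ l ∈ Finset.range (m + 1), (X - Polynomial.C (v (i + 1 + l)))) * this

theorem eval_newtonPoly
    (h : ∀ j i, i + j + 1 ≤ M → g j (i + 1) - g j i = (v (i + j + 1) - v i) * g (j + 1) i) :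
    ∀ m i l, i + m ≤ M → l ≤ m → (newtonPoly v g m i).eval (v (i + l)) = g 0 (i + l)
  | 0, i, l, hi, hl => by
    obtain rfl : l = 0 := by omega
    simp [newtonPoly]
  | m + 1, i, l, hi, hl => by
    rcases Nat.lt_or_ge l (m + 1) with hl' | hl'
    · rw [newtonPoly, eval_add, eval_newtonPoly h m i l (by omega) (by omega), eval_mul,
        eval_prod, Finset.prod_eq_zero (Finset.mem_range.2 hl') (by simp), mul_zero, add_zero]
    · obtain rfl : l = m + 1 := by omega
      rw [newtonPoly_succ_left h m i (by omega), show i + (m + 1) = i + 1 + m by ring, eval_add,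
        eval_newtonPoly h m (i + 1) m (by omega) le_rfl, eval_mul, eval_prod,
        Finset.prod_eq_zero (Finset.mem_range.2 (Nat.lt_succ_self m)) (by simp), mul_zero, add_zero]

/-- A divided difference table without denominators yields an interpolation polynomial. -/
theorem exists_interpolant
    (h : ∀ j i, i + j + 1 ≤ M → g j (i + 1) - g j i = (v (i + j + 1) - v i) * g (j + 1) i) :
    ∃ ρ : R[X], ∀ i ≤ M, ρ.eval (v i) = g 0 i :=
  ⟨newtonPoly v g M 0, fun i hi => by simpa using eval_newtonPoly h M 0 i (by omega) hi⟩

end Alternant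

/-! ### Invariants of an involution in an algebra with two generators. -/

section Symmetric

variable {K X : Type*} [Field K]

/-- Both generators are roots of the quadratic Z² - S(E) Z + T(E), so K[w, w'] = K[E] + K[E] w. -/
theorem exists_eval_add_eval_mul {E w w' : X → K} {S T : K[X]}
    (hS : ∀ x, w x + w' x = S.eval (E x)) (hT : ∀ x, w x * w' x = T.eval (E x))
    {f : X → K} (hf : f ∈ Algebra.adjoin K ({w, w'} : Set (X → K))) :
    ∃ s t : K[X], ∀ x, f x = s.eval (E x) + t.eval (E x) * w x := by
  induction hf using Algebra.adjoin_induction with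
  | mem f hf =>
    rcases hf with rfl | rfl
    · exact ⟨0, 1, fun x => by simp⟩
    · exact ⟨S, -1, fun x => by simp [← hS]⟩
  | algebraMap c => exact ⟨Polynomial.C c, 0, fun x => by simp⟩
  | add f g _ _ hf hg =>
    obtain ⟨s, t, h⟩ := hf
    obtain ⟨s', t', h'⟩ := hg
    exact ⟨s + s', t + t', fun x => by simp [h, h']; ring⟩
  | mul f g _ _ hf hg =>
    obtain ⟨s, t, h⟩ := hf
    obtain ⟨s', t', h'⟩ := hg
    refine ⟨s * s' - t * t' * T, s * t' + t * s' + t * t' * S, fun x => ?_⟩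
    simp only [Pi.mul_apply, h, h', eval_add, eval_sub, eval_mul, ← hS, ← hT]
    ring

/-- A function in `K[w, w']` which is invariant under an involution exchanging `w` and `w'` is a
polynomial in the coordinate `E`. -/
theorem exists_eval_of_invariant [CharZero K] {E w w' : X → K} {S T : K[X]} {σ : X → X}
    (hE : ∀ x, E (σ x) = E x) (hw : ∀ x, w (σ x) = w' x)
    (hS : ∀ x, w x + w' x = S.eval (E x)) (hT : ∀ x, w x * w' x = T.eval (E x))
    {f : X → K} (hf : f ∈ Algebra.adjoin K ({w, w'} : Set (X → K))) :
    ∃ Q : K[X], ∀ x, f (σ x) = f x → Q.eval (E x) = f x := by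
  obtain ⟨s, t, h⟩ := exists_eval_add_eval_mul hS hT hf
  -- This is the average of s + t w and s + t w'. It is chosen before `x`, so invariance of `f` is
  -- needed only at the points where the value is claimed.
  refine ⟨s + Polynomial.C (2⁻¹) * t * S, fun x hx => ?_⟩
  have h1 := h x
  have h2 := h (σ x)
  rw [hx, hE, hw] at h2
  simp only [eval_add, eval_mul, eval_C, ← hS]
  have h3 : (2 : K) ≠ 0 := two_ne_zero
  have : 2 * f x = 2 * (eval (E x) s + 2⁻¹ * eval (E x) t * (w x + w' x)) := by
    field_simp
    linear_combination h1 + h2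
  exact (mul_left_cancel₀ h3 this).symm

end Symmetric

/-! ### Products of shifted tridiagonal matrices. -/

section Band

variable {K : Type*} [Field K]

/-- The entry `(n, m)` of `∏ (J - e)`, where `J` is the tridiagonal matrix with coefficients
`A`, `B`, `C`. -/
def bandCoeff (A B C : ℤ → K) : List K → ℤ → ℤ → K
  | [], n, m => if m = n ∧ 0 ≤ n then 1 else 0
  | e :: l, n, m => A n * bandCoeff A B C l (n + 1) m + (B n - e) * bandCoeff A B C l n m
      + C n * bandCoeff A B C l (n - 1) m

variable {A B C : ℤ → K}

/-- The factors J - e are all polynomials in J, so they commute. This is the source of the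
reflection symmetry of the recurrence coefficients. -/
theorem bandCoeff_perm {l l' : List K} (h : l.Perm l') :
    ∀ n m, bandCoeff A B C l n m = bandCoeff A B C l' n m := by
  induction h with
  | nil => exact fun _ _ => rfl
  | cons e _ ih => intro n m; simp only [bandCoeff, ih]
  | swap e e' l =>
    intro n m
    simp only [bandCoeff, add_sub_cancel_right, sub_add_cancel]
    ring
  | trans _ _ h1 h2 => intro n m; rw [h1, h2]

theorem bandCoeff_of_length_lt : ∀ (l : List K) (n m : ℤ), (l.length : ℤ) < |m - n| →
    bandCoeff A B C l n m = 0
  | [], n, m, h => by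
    have : m ≠ n := by rintro rfl; simp at h
    simp [bandCoeff, this]
  | e :: l, n, m, h => by
    simp only [List.length_cons, Nat.cast_add, Nat.cast_one] at h
    have h1 : (l.length : ℤ) < |m - (n + 1)| := by grind
    have h2 : (l.length : ℤ) < |m - n| := by grind
    have h3 : (l.length : ℤ) < |m - (n - 1)| := by grind
    simp [bandCoeff, bandCoeff_of_length_lt l _ _ h1, bandCoeff_of_length_lt l _ _ h2,
      bandCoeff_of_length_lt l _ _ h3]

theorem bandCoeff_of_right_neg : ∀ (l : List K) (n m : ℤ), m < 0 → bandCoeff A B C l n m = 0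
  | [], n, m, h => by
    have : ¬ (m = n ∧ 0 ≤ n) := by omega
    simp [bandCoeff, this]
  | e :: l, n, m, h => by simp [bandCoeff, bandCoeff_of_right_neg l _ m h]

/-- The only passage from negative to nonnegative indices is the step -1 → 0, whose weight is `A
(-1)`. -/
theorem bandCoeff_of_left_neg (hA : A (-1) = 0) :
    ∀ (l : List K) (n m : ℤ), n < 0 → bandCoeff A B C l n m = 0
  | [], n, m, h => by
    have : ¬ (m = n ∧ 0 ≤ n) := by omega
    simp [bandCoeff, this]
  | e :: l, n, m, h => by
    have h1 : A n * bandCoeff A B C l (n + 1) m = 0 := by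
      rcases eq_or_ne n (-1) with rfl | hn
      · simp [hA]
      · rw [bandCoeff_of_left_neg hA l (n + 1) m (by omega), mul_zero]
    simp [bandCoeff, h1, bandCoeff_of_left_neg hA l n m h,
      bandCoeff_of_left_neg hA l (n - 1) m (by omega)]

/-- Each factor J - e multiplies an eigenvector of J by z - e. The eigenvector equation is known
only below `N`, which suffices since row `n` of the product reaches no further than `n + l.length`.
-/
theorem sum_bandCoeff_mul {N : ℤ} {z : K} {Ψ : ℤ → K} (hA : A (-1) = 0) (hC : C 0 = 0)
    (h : ∀ n : ℤ, 0 ≤ n → n < N → z * Ψ n = A n * Ψ (n + 1) + B n * Ψ n + C n * Ψ (n - 1)) :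
    ∀ (l : List K) (n : ℤ), 0 ≤ n → n + l.length ≤ N →
      ∑ m ∈ Finset.Icc 0 N, bandCoeff A B C l n m * Ψ m = (l.map (z - ·)).prod * Ψ n
  | [], n, hn, hN => by
    simp only [List.length_nil, Nat.cast_zero, add_zero] at hN
    rw [Finset.sum_eq_single n]
    · simp [bandCoeff, hn]
    · intro m _ hm
      simp [bandCoeff, hm]
    · intro hm
      exact absurd (Finset.mem_Icc.2 ⟨hn, hN⟩) hm
  | e :: l, n, hn, hN => by
    simp only [List.length_cons, Nat.cast_add, Nat.cast_one] at hN
    have h1 := sum_bandCoeff_mul hA hC h l (n + 1) (by omega) (by omega)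
    have h2 := sum_bandCoeff_mul hA hC h l n hn (by omega)
    have h3 : C n * ∑ m ∈ Finset.Icc 0 N, bandCoeff A B C l (n - 1) m * Ψ m
        = C n * ((l.map (z - ·)).prod * Ψ (n - 1)) := by
      rcases hn.eq_or_lt with rfl | hn'
      · simp [hC]
      · rw [sum_bandCoeff_mul hA hC h l (n - 1) (by omega) (by omega)]
    have h4 : ∑ m ∈ Finset.Icc 0 N, bandCoeff A B C (e :: l) n m * Ψ m
        = A n * ∑ m ∈ Finset.Icc 0 N, bandCoeff A B C l (n + 1) m * Ψ m
          + (B n - e) * ∑ m ∈ Finset.Icc 0 N, bandCoeff A B C l n m * Ψ m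
          + C n * ∑ m ∈ Finset.Icc 0 N, bandCoeff A B C l (n - 1) m * Ψ m := by
      simp only [Finset.mul_sum, ← Finset.sum_add_distrib, bandCoeff]
      exact Finset.sum_congr rfl fun m _ => by ring
    rw [h4, h1, h2, h3, List.map_cons, List.prod_cons]
    linear_combination -(l.map (z - ·)).prod * h n hn (by omega)

end Band

/-! ### Nonvanishing of q-binomial coefficients. -/

section QBinomial

variable {K : Type*} [Field K]

/-- The substitution X ↦ yX shifts the roots, which gives the functional equation `hfun`. Comparing
coefficients of X^{k+1} there ties two consecutive coefficients together with the factor y^{t-k} - 1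
≠ 0, so a zero coefficient would propagate down to the constant term. -/
theorem coeff_prod_X_sub_pow_ne_zero {y : K} (hy : y ≠ 0) (h : ∀ k : ℕ, 1 ≤ k → y ^ k ≠ 1)
    (t : ℕ) : ∀ k ≤ t, (∏ i ∈ Finset.range t, (X - Polynomial.C (y ^ i))).coeff k ≠ 0 := by
  have hfun : ∀ t : ℕ, (Polynomial.C y * X - Polynomial.C (y ^ t))
      * (∏ i ∈ Finset.range t, (X - Polynomial.C (y ^ i))).comp (Polynomial.C y * X)
      = Polynomial.C (y ^ t) * (Polynomial.C y * X - 1)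
        * ∏ i ∈ Finset.range t, (X - Polynomial.C (y ^ i)) := by
    intro t
    induction t with
    | zero => simp
    | succ t ih =>
      rw [Finset.prod_range_succ, mul_comp]
      have : (X - Polynomial.C (y ^ t)).comp (Polynomial.C y * X)
          = Polynomial.C y * X - Polynomial.C (y ^ t) := by simp
      rw [this]
      have e : Polynomial.C (y ^ (t + 1)) = Polynomial.C y * Polynomial.C (y ^ t) := by
        rw [← map_mul, pow_succ']
      rw [e]
      linear_combination (Polynomial.C y * X - Polynomial.C y * Polynomial.C (y ^ t)) * ih
  intro k
  induction k with
  | zero =>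
    intro _
    rw [coeff_zero_eq_eval_zero, eval_prod]
    refine Finset.prod_ne_zero_iff.2 fun i _ => ?_
    simpa using fun h => absurd h hy
  | succ k ih =>
    intro hk h0
    have h1 := congrArg (fun P => P.coeff (k + 1)) (hfun t)
    set P := ∏ i ∈ Finset.range t, (X - Polynomial.C (y ^ i))
    simp only [sub_mul, mul_sub, mul_assoc, coeff_sub, coeff_C_mul, coeff_X_mul,
      comp_C_mul_X_coeff, h0, mul_zero, one_mul, sub_zero, zero_mul] at h1
    have h2 : P.coeff k * (y ^ (k + 1) * (y ^ (t - k) - 1)) = 0 := by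
      have e : y ^ (k + 1) * y ^ (t - k) = y * y ^ t := by
        rw [← pow_add, ← pow_succ']; congr 1; omega
      linear_combination P.coeff k * e - h1
    rcases mul_eq_zero.1 h2 with h3 | h3
    · exact ih (by omega) h3
    · rcases mul_eq_zero.1 h3 with h4 | h4
      · exact pow_ne_zero _ hy h4
      · exact h (t - k) (by omega) (sub_eq_zero.1 h4)

end QBinomial

end MultiRacah

/-! ### The reflection, the algebra of coordinate functions, and the factors of r and φ. -/

namespace MultiRacah

namespace Params

variable {K : Type*} [Field K] {p : Params K} {u : K} {M : ℕ}

/-- `q ≠ 0` is not a root of unity, and the parameters `q ^ lam` are nonzero. -/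
def Nondeg (p : Params K) : Prop :=
  match p.kind with
  | .racah => True
  | .qRacah q => q ≠ 0 ∧ (∀ k : ℕ, 1 ≤ k → q ^ k ≠ 1) ∧ p.a ≠ 0 ∧ p.b ≠ 0 ∧ p.c ≠ 0 ∧ p.d ≠ 0

/-- The reflection `x ↦ -x - d - M`, under which `η(x; lam + M δ)` is invariant. -/
def refl (p : Params K) (M : ℕ) (u : K) : K :=
  match p.kind with
  | .racah => -u - p.d - (M : K)
  | .qRacah q => (p.d * q ^ M * u)⁻¹

/-- The coordinate `x`, resp. `q ^ (-x)`. -/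
def coord (p : Params K) (u : K) : K :=
  match p.kind with
  | .racah => u
  | .qRacah _ => u⁻¹

/-- The factors of `r` which depend on `a`, `b`. -/
def facF (p : Params K) (u : K) : K :=
  match p.kind with
  | .racah => (u + p.a) * (u + p.b)
  | .qRacah q => (1 - p.a * u) * (1 - p.b * u) / (p.a * p.b * p.d⁻¹ * q⁻¹ * u)

/-- The factors of `r` which depend on the twists of `a`, `b`. -/
def facG (p : Params K) (u : K) : K :=
  match p.kind with
  | .racah => (u + p.d - p.a + 1) * (u + p.d - p.b + 1)
  | .qRacah q => (1 - p.a⁻¹ * p.d * q * u) * (1 - p.b⁻¹ * p.d * q * u) / u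

theorem Nondeg.twist (hp : p.Nondeg) : p.twist.Nondeg := by
  obtain ⟨_ | q, a, b, c, d⟩ := p
  · trivial
  · obtain ⟨h1, h2, h3, h4, h5, h6⟩ := hp
    simp only at h3 h4 h5 h6
    exact ⟨h1, h2, by simp [Params.twist, *], by simp [Params.twist, *], h5, h6⟩

theorem isPoint_adv (hp : p.Nondeg) (hu : p.IsPoint u) (j : ℕ) : p.IsPoint (p.adv j u) := by
  obtain ⟨_ | q, a, b, c, d⟩ := p
  · trivial
  · exact mul_ne_zero hu (pow_ne_zero _ hp.1)

theorem isPoint_refl (hp : p.Nondeg) (hu : p.IsPoint u) (M : ℕ) : p.IsPoint (p.refl M u) := by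
  obtain ⟨_ | q, a, b, c, d⟩ := p
  · trivial
  · obtain ⟨h1, h2, h3, h4, h5, h6⟩ := hp
    exact inv_ne_zero (mul_ne_zero (mul_ne_zero h6 (pow_ne_zero _ h1)) hu)

theorem isPoint_origin : p.IsPoint p.origin := by
  obtain ⟨_ | q, a, b, c, d⟩ := p
  · trivial
  · exact one_ne_zero

theorem adv_zero : p.adv 0 u = u := by
  obtain ⟨_ | q, a, b, c, d⟩ := p <;> simp [adv]

theorem adv_adv (i j : ℕ) : p.adv i (p.adv j u) = p.adv (j + i) u := by
  obtain ⟨_ | q, a, b, c, d⟩ := p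
  · simp [adv, add_assoc]
  · simp [adv, mul_assoc, pow_add]

theorem eta_adv_refl (hp : p.Nondeg) (hu : p.IsPoint u) {i : ℕ} (hi : i ≤ M) :
    p.eta (p.adv i (p.refl M u)) = p.eta (p.adv (M - i) u) := by
  obtain ⟨k, rfl⟩ := Nat.exists_eq_add_of_le hi
  rw [Nat.add_sub_cancel_left]
  obtain ⟨_ | q, a, b, c, d⟩ := p
  · simp only [eta, adv, refl]; push_cast; ring
  · obtain ⟨h1, h2, h3, h4, h5, h6⟩ := hp
    simp only [IsPoint] at hu
    simp only at h6
    simp only [eta, adv, refl]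
    field_simp
    ring

theorem shift_eta_refl (hp : p.Nondeg) (hu : p.IsPoint u) :
    (p.shift M).eta (p.refl M u) = (p.shift M).eta u := by
  obtain ⟨_ | q, a, b, c, d⟩ := p
  · simp only [eta, shift, refl]; ring
  · obtain ⟨h1, h2, h3, h4, h5, h6⟩ := hp
    simp only [IsPoint] at hu
    simp only at h6
    simp only [eta, shift, refl]
    field_simp
    ring

theorem exists_coord_add (hp : p.Nondeg) (M : ℕ) : ∃ S : K[X], ∀ u, p.IsPoint u →
    p.coord u + p.coord (p.refl M u) = S.eval ((p.shift M).eta u) := by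
  obtain ⟨_ | q, a, b, c, d⟩ := p
  · exact ⟨Polynomial.C (-d - (M : K)), fun u _ => by simp only [coord, refl, eval_C]; ring⟩
  · obtain ⟨h1, h2, h3, h4, h5, h6⟩ := hp
    refine ⟨X + Polynomial.C (1 + d * q ^ M), fun u hu => ?_⟩
    simp only [IsPoint] at hu
    simp only at h6
    simp only [coord, refl, shift, eta, eval_add, eval_X, eval_C]
    field_simp
    ring

theorem exists_coord_mul (hp : p.Nondeg) (M : ℕ) : ∃ T : K[X], ∀ u, p.IsPoint u →
    p.coord u * p.coord (p.refl M u) = T.eval ((p.shift M).eta u) := by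
  obtain ⟨_ | q, a, b, c, d⟩ := p
  · exact ⟨-X, fun u _ => by simp only [coord, refl, shift, eta, eval_neg, eval_X]; ring⟩
  · obtain ⟨h1, h2, h3, h4, h5, h6⟩ := hp
    refine ⟨Polynomial.C (d * q ^ M), fun u hu => ?_⟩
    simp only [IsPoint] at hu
    simp only at h6
    simp only [coord, refl, eval_C]
    field_simp

/-- The reflection exchanges the two kinds of factors of `r`, so it reverses the order of r_0, …,
r_M (see `r_refl`). -/
theorem facF_adv_refl (hp : p.Nondeg) (hu : p.IsPoint u) {l k : ℕ} :
    p.facF (p.adv l (p.refl (l + k + 1) u)) = p.facG (p.adv k u) := by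
  obtain ⟨_ | q, a, b, c, d⟩ := p
  · simp only [facF, facG, adv, refl]; push_cast; ring
  · obtain ⟨h1, h2, h3, h4, h5, h6⟩ := hp
    simp only [IsPoint] at hu
    simp only at h6 h3 h4
    simp only [facF, facG, adv, refl]
    field_simp
    ring

theorem facG_adv_refl (hp : p.Nondeg) (hu : p.IsPoint u) {l k : ℕ} :
    p.facG (p.adv l (p.refl (l + k + 1) u)) = p.facF (p.adv k u) := by
  obtain ⟨_ | q, a, b, c, d⟩ := p
  · simp only [facF, facG, adv, refl]; push_cast; ring
  · obtain ⟨h1, h2, h3, h4, h5, h6⟩ := hp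
    simp only [IsPoint] at hu
    simp only at h6 h3 h4
    simp only [facF, facG, adv, refl]
    field_simp
    ring

/-- Both sides are antisymmetric under the reflection x ↦ -x-d-(j+1). That the ratio κ is
independent of the point is what gives the divided differences of `r` a closed form. -/
theorem exists_facF_sub_facG [CharZero K] (hp : p.Nondeg) (j : ℕ) : ∃ κ : K, ∀ u, p.IsPoint u →
    p.facF u - p.facG (p.adv j u) = κ * (p.eta (p.adv (j + 1) u) - p.eta u) := by
  obtain ⟨_ | q, a, b, c, d⟩ := p
  · refine ⟨(a + b - d - j - 1) / (j + 1), fun u _ => ?_⟩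
    have : (j : K) + 1 ≠ 0 := Nat.cast_add_one_ne_zero j
    simp only [facF, facG, adv, eta]
    push_cast
    field_simp
    ring
  · obtain ⟨h1, h2, h3, h4, h5, h6⟩ := hp
    -- κ is the ratio of the coefficients of u⁻¹; in the Racah case it is the ratio of the
    -- coefficients of x.
    refine ⟨((a * b * d⁻¹ * q⁻¹)⁻¹ - (q ^ j)⁻¹) / ((q ^ (j + 1))⁻¹ - 1), fun u hu => ?_⟩
    have h7 : (q ^ (j + 1))⁻¹ - 1 ≠ 0 := by
      rw [sub_ne_zero, ne_eq, inv_eq_one]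
      exact h2 (j + 1) (by omega)
    simp only [IsPoint] at hu
    simp only at h6 h3 h4
    rw [div_mul_eq_mul_div, eq_div_iff h7]
    simp only [facF, facG, adv, eta]
    field_simp
    ring

theorem exists_r_eq (hp : p.Nondeg) (M : ℕ) : ∃ ν : K, ∀ u i, i ≤ M → p.r M i u
    = ν * ((∏ l ∈ Finset.range i, p.facF (p.adv l u))
      * ∏ l ∈ Finset.range (M - i), p.facG (p.adv (i + l) u)) := by
  obtain ⟨_ | q, a, b, c, d⟩ := p
  · refine ⟨(Kind.racah.poch (d - a + 1) M * Kind.racah.poch (d - b + 1) M)⁻¹, fun u i _ => ?_⟩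
    rw [← div_eq_inv_mul]
    simp only [r, facF, facG, adv]
    congr 1
    simp only [Kind.poch, ← Finset.prod_mul_distrib, mul_assoc]
    congr 1
    · exact Finset.prod_congr rfl fun l _ => by ring
    · exact Finset.prod_congr rfl fun l _ => by push_cast; ring
  · obtain ⟨h1, h2, h3, h4, h5, h6⟩ := hp
    simp only at h6 h3 h4
    -- The factor with shift l carries q^{-l} in its denominator. The shifts of the F and G factors
    -- together exhaust 0, …, M-1, so the compensating power of q does not depend on i.
    refine ⟨((Kind.qRacah q).poch (a⁻¹ * d * q) M * (Kind.qRacah q).poch (b⁻¹ * d * q) M)⁻¹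
      * ∏ l ∈ Finset.range M, q ^ l, fun u i hi => ?_⟩
    obtain ⟨k, rfl⟩ := Nat.exists_eq_add_of_le hi
    rw [mul_assoc, Nat.add_sub_cancel_left, Finset.prod_range_add]
    have e1 : (∏ l ∈ Finset.range i, q ^ l) * ∏ l ∈ Finset.range i,
        facF ⟨.qRacah q, a, b, c, d⟩ (adv ⟨.qRacah q, a, b, c, d⟩ l u)
        = (Kind.qRacah q).poch (a * u) i * (Kind.qRacah q).poch (b * u) i
          / ((a * b * d⁻¹ * q⁻¹) ^ i * u ^ i) := by
      rw [← Finset.prod_mul_distrib, ← mul_pow]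
      simp only [Kind.poch, ← Finset.prod_mul_distrib]
      rw [show (a * b * d⁻¹ * q⁻¹ * u) ^ i = ∏ _l ∈ Finset.range i, (a * b * d⁻¹ * q⁻¹ * u) by simp,
        ← Finset.prod_div_distrib]
      refine Finset.prod_congr rfl fun l _ => ?_
      have := pow_ne_zero l h1
      simp only [facF, adv]
      rw [show a * b * d⁻¹ * q⁻¹ * (u * q ^ l) = q ^ l * (a * b * d⁻¹ * q⁻¹ * u) by ring,
        ← mul_div_assoc, mul_div_mul_left _ _ this]
      ring
    have e2 : (∏ l ∈ Finset.range k, q ^ (i + l)) * ∏ l ∈ Finset.range k,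
        facG ⟨.qRacah q, a, b, c, d⟩ (adv ⟨.qRacah q, a, b, c, d⟩ (i + l) u)
        = (Kind.qRacah q).poch (a⁻¹ * d * u * q ^ (i + 1)) k
          * (Kind.qRacah q).poch (b⁻¹ * d * u * q ^ (i + 1)) k / u ^ k := by
      rw [← Finset.prod_mul_distrib]
      simp only [Kind.poch, ← Finset.prod_mul_distrib]
      rw [show (u) ^ k = ∏ _l ∈ Finset.range k, (u) by simp,
        ← Finset.prod_div_distrib]
      refine Finset.prod_congr rfl fun l _ => ?_
      have := pow_ne_zero (i + l) h1
      simp only [facG, adv]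
      rw [mul_comm u, ← mul_div_assoc, mul_div_mul_left _ _ this]
      ring
    rw [mul_mul_mul_comm, e1, e2]
    simp only [r]
    rw [Nat.add_sub_cancel_left, div_mul_div_comm, pow_add]
    ring

/-- The two Pochhammer symbols containing x pair up factor by factor: (-x+i)(x+d+i) = i(i+d) - η(x),
and similarly in the q-case. -/
theorem exists_cP_eq_eval (hp : p.Nondeg) (n : ℕ) :
    ∃ Q : K[X], ∀ u, p.IsPoint u → p.cP n u = Q.eval (p.eta u) := by
  obtain ⟨_ | q, a, b, c, d⟩ := p
  · refine ⟨∑ k ∈ Finset.range (n + 1), Polynomial.C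
      (Kind.racah.poch (-(n : K)) k
        * Kind.racah.poch ((n : K) + dt ⟨.racah, a, b, c, d⟩) k
      / (Kind.racah.poch a k * Kind.racah.poch b k * Kind.racah.poch c k * Kind.racah.poch 1 k))
      * ∏ i ∈ Finset.range k, (Polynomial.C ((i : K) * (i + d)) - X), fun u _ => ?_⟩
    simp only [cP, eval_finsetSum, eval_mul, eval_C, eval_prod, eval_sub, eval_X]
    refine Finset.sum_congr rfl fun k _ => ?_
    have : ∏ i ∈ Finset.range k, ((i : K) * (i + d) - eta ⟨.racah, a, b, c, d⟩ u)
        = Kind.racah.poch (-u) k * Kind.racah.poch (u + d) k := by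
      simp only [Kind.poch, ← Finset.prod_mul_distrib, eta]
      exact Finset.prod_congr rfl fun i _ => by ring
    rw [this]
    ring
  · refine ⟨∑ k ∈ Finset.range (n + 1), Polynomial.C
      ((Kind.qRacah q).poch ((q ^ n)⁻¹) k
        * (Kind.qRacah q).poch (dt ⟨.qRacah q, a, b, c, d⟩ * q ^ n) k
      / ((Kind.qRacah q).poch a k * (Kind.qRacah q).poch b k * (Kind.qRacah q).poch c k
        * (Kind.qRacah q).poch q k) * q ^ k)
      * ∏ i ∈ Finset.range k, (Polynomial.C (1 + d * q ^ (2 * i) - q ^ i * (1 + d))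
        - Polynomial.C (q ^ i) * X), fun u hu => ?_⟩
    simp only [IsPoint] at hu
    simp only [cP, eval_finsetSum, eval_mul, eval_C, eval_prod, eval_sub, eval_X]
    refine Finset.sum_congr rfl fun k _ => ?_
    have : ∏ i ∈ Finset.range k, ((1 + d * q ^ (2 * i) - q ^ i * (1 + d))
          - q ^ i * eta ⟨.qRacah q, a, b, c, d⟩ u)
        = (Kind.qRacah q).poch (u⁻¹) k * (Kind.qRacah q).poch (d * u) k := by
      simp only [Kind.poch, ← Finset.prod_mul_distrib, eta]
      refine Finset.prod_congr rfl fun i _ => ?_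
      field_simp
      ring
    rw [this]
    ring

theorem twist_eta : p.twist.eta u = p.eta u := by
  obtain ⟨_ | q, a, b, c, d⟩ := p <;> rfl

theorem exists_cXi_eq_eval (hp : p.Nondeg) (v : ℕ) :
    ∃ Q : K[X], ∀ u, p.IsPoint u → p.cXi v u = Q.eval (p.eta u) := by
  obtain ⟨Q, hQ⟩ := exists_cP_eq_eval hp.twist v
  refine ⟨Q, fun u hu => ?_⟩
  rw [cXi, hQ u (by obtain ⟨_ | q, a, b, c, d⟩ := p <;> exact hu), twist_eta]

/-- The algebra of functions of points generated by `coord` and its reflection. -/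
def coordAlg (p : Params K) (M : ℕ) : Subalgebra K ({u // p.IsPoint u} → K) :=
  Algebra.adjoin K {fun u : {u // p.IsPoint u} => p.coord u,
    fun u : {u // p.IsPoint u} => p.coord (p.refl M u)}

/-- In the q-case the reflected coordinate is d q^M u, so the algebra contains both u and u⁻¹. -/
theorem exists_generators (hp : p.Nondeg) (M : ℕ) :
    (fun u : {u // p.IsPoint u} => (u : K)) ∈ p.coordAlg M
      ∧ (fun u : {u // p.IsPoint u} => p.coord u) ∈ p.coordAlg M := by
  have h1 : (fun u : {u // p.IsPoint u} => p.coord u) ∈ p.coordAlg M :=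
    Algebra.subset_adjoin (by simp)
  have h2 : (fun u : {u // p.IsPoint u} => p.coord (p.refl M u)) ∈ p.coordAlg M :=
    Algebra.subset_adjoin (by simp)
  refine ⟨?_, h1⟩
  obtain ⟨_ | q, a, b, c, d⟩ := p
  · exact h1
  · obtain ⟨h3, h4, h5, h6, h7, h8⟩ := hp
    simp only at h8
    have := (coordAlg ⟨.qRacah q, a, b, c, d⟩ M).smul_mem h2 ((d * q ^ M)⁻¹)
    convert this using 1
    ext u
    simp only [Pi.smul_apply, coord, refl, smul_eq_mul]
    field_simp

theorem const_mem_coordAlg (x : K) : (fun _ : {u // p.IsPoint u} => x) ∈ p.coordAlg M :=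
  (p.coordAlg M).algebraMap_mem x

theorem eta_adv_mem_coordAlg (hp : p.Nondeg) (i : ℕ) :
    (fun u : {u // p.IsPoint u} => p.eta (p.adv i u)) ∈ p.coordAlg M := by
  obtain ⟨h1, h2⟩ := exists_generators hp M
  have hc := const_mem_coordAlg (p := p) (M := M)
  set S := p.coordAlg M
  obtain ⟨_ | q, a, b, c, d⟩ := p
  · exact S.mul_mem (S.add_mem h1 (hc i)) (S.add_mem (S.add_mem h1 (hc i)) (hc d))
  · have := S.mul_mem (S.sub_mem (S.mul_mem h2 (hc (q ^ i)⁻¹)) S.one_mem)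
      (S.sub_mem S.one_mem (S.mul_mem (hc (d * q ^ i)) h1))
    convert this using 1
    ext u
    simp only [eta, adv, coord, Pi.mul_apply, Pi.sub_apply, Pi.one_apply, mul_inv]
    ring

theorem facF_adv_mem_coordAlg (hp : p.Nondeg) (i : ℕ) :
    (fun u : {u // p.IsPoint u} => p.facF (p.adv i u)) ∈ p.coordAlg M := by
  obtain ⟨h1, h2⟩ := exists_generators hp M
  have hc := const_mem_coordAlg (p := p) (M := M)
  set S := p.coordAlg M
  obtain ⟨_ | q, a, b, c, d⟩ := p
  · exact S.mul_mem (S.add_mem (S.add_mem h1 (hc i)) (hc a))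
      (S.add_mem (S.add_mem h1 (hc i)) (hc b))
  · have := S.mul_mem (S.mul_mem (S.sub_mem S.one_mem (S.mul_mem (hc (a * q ^ i)) h1))
      (S.sub_mem S.one_mem (S.mul_mem (hc (b * q ^ i)) h1)))
      (S.mul_mem h2 (hc (a * b * d⁻¹ * q⁻¹ * q ^ i)⁻¹))
    convert this using 1
    ext u
    simp only [facF, adv, coord, Pi.mul_apply, Pi.sub_apply, Pi.one_apply, mul_inv, div_eq_mul_inv]
    ring

theorem facG_adv_mem_coordAlg (hp : p.Nondeg) (i : ℕ) :
    (fun u : {u // p.IsPoint u} => p.facG (p.adv i u)) ∈ p.coordAlg M := by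
  obtain ⟨h1, h2⟩ := exists_generators hp M
  have hc := const_mem_coordAlg (p := p) (M := M)
  set S := p.coordAlg M
  obtain ⟨_ | q, a, b, c, d⟩ := p
  · exact S.mul_mem (S.add_mem (S.sub_mem (S.add_mem (S.add_mem h1 (hc i)) (hc d)) (hc a))
      S.one_mem) (S.add_mem (S.sub_mem (S.add_mem (S.add_mem h1 (hc i)) (hc d)) (hc b)) S.one_mem)
  · have := S.mul_mem (S.mul_mem
      (S.sub_mem S.one_mem (S.mul_mem (hc (a⁻¹ * d * q * q ^ i)) h1))
      (S.sub_mem S.one_mem (S.mul_mem (hc (b⁻¹ * d * q * q ^ i)) h1)))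
      (S.mul_mem h2 (hc (q ^ i)⁻¹))
    convert this using 1
    ext u
    simp only [facG, adv, coord, Pi.mul_apply, Pi.sub_apply, Pi.one_apply, mul_inv, div_eq_mul_inv]
    ring

theorem eta_adv_add_sub (hp : p.Nondeg) (hu : p.IsPoint u) (j m : ℕ) :
    p.eta (p.adv (j + m) u) - p.eta (p.adv j u) =
      match p.kind with
      | .racah => (m : K) * (2 * u + p.d + ((2 * j + m : ℕ) : K))
      | .qRacah q => (u * q ^ (j + m))⁻¹ * ((1 - q ^ m) * (1 - p.d * q ^ (2 * j + m) * u ^ 2)) := by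
  obtain ⟨_ | q, a, b, c, d⟩ := p
  · simp only [eta, adv]; push_cast; ring
  · obtain ⟨h1, h2, h3, h4, h5, h6⟩ := hp
    simp only [IsPoint] at hu
    simp only [eta, adv]
    field_simp
    ring

theorem eta_origin : p.eta p.origin = 0 := by
  obtain ⟨_ | q, a, b, c, d⟩ := p <;> simp [eta, origin]

theorem eta_adv_sub_origin_ne_zero [CharZero K] (hp : p.Nondeg) {N : ℕ}
    (hd : p.kind.poch p.d N ≠ 0) {j m : ℕ} (hm : 1 ≤ m) (h : 2 * j + m < N) :
    p.eta (p.adv (j + m) p.origin) - p.eta (p.adv j p.origin) ≠ 0 := by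
  rw [eta_adv_add_sub hp isPoint_origin]
  obtain ⟨_ | q, a, b, c, d⟩ := p
  · have := Finset.prod_ne_zero_iff.1 hd _ (Finset.mem_range.2 h)
    simp only [origin, mul_zero, zero_add]
    exact mul_ne_zero (Nat.cast_ne_zero.2 (by omega)) this
  · have := Finset.prod_ne_zero_iff.1 hd _ (Finset.mem_range.2 h)
    obtain ⟨h1, h2, h3, h4, h5, h6⟩ := hp
    simp only [origin, one_mul, one_pow, mul_one]
    exact mul_ne_zero (inv_ne_zero (pow_ne_zero _ h1))
      (mul_ne_zero (sub_ne_zero.2 (h2 m hm).symm) this)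

theorem prod_range_range_eq {K : Type*} [CommMonoid K] (f : ℕ → ℕ → K) (M : ℕ) :
    ∏ k ∈ Finset.range M, ∏ j ∈ Finset.range k, f j k
      = ∏ i : Fin M, ∏ j ∈ Finset.Ioi i, f i j := by
  rw [Finset.prod_comm' (t' := Finset.univ) (s' := fun j : Fin M => Finset.Iio j) (by simp),
    Finset.prod_range fun k => ∏ j ∈ Finset.range k, f j k]
  refine Finset.prod_congr rfl fun k _ => ?_
  rw [← Nat.Iio_eq_range, ← Fin.map_valEmbedding_Iio, Finset.prod_map]
  rfl

/-- The Vandermonde product of the `η(x + i)`, `0 ≤ i < M`. -/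
def etaVand (p : Params K) (M : ℕ) (u : K) : K :=
  ∏ i : Fin M, ∏ j ∈ Finset.Ioi i, (p.eta (p.adv (j : ℕ) u) - p.eta (p.adv (i : ℕ) u))

theorem exists_phi_eq [CharZero K] (hp : p.Nondeg) {M N : ℕ} (hd : p.kind.poch p.d N ≠ 0)
    (hM : 2 * M ≤ N + 2) :
    ∃ c : K, c ≠ 0 ∧ ∀ u, p.phi M u = c * p.etaVand M u := by
  refine ⟨(∏ k ∈ Finset.range M, ∏ j ∈ Finset.range k, p.eta (p.adv (k - j) p.origin))⁻¹, ?_,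
    fun u => ?_⟩
  · refine inv_ne_zero (Finset.prod_ne_zero_iff.2 fun k hk => Finset.prod_ne_zero_iff.2
      fun j hj => ?_)
    rw [Finset.mem_range] at hk hj
    have := eta_adv_sub_origin_ne_zero hp hd (j := 0) (m := k - j) (by omega) (by omega)
    rwa [adv_zero, eta_origin, sub_zero, zero_add] at this
  · rw [etaVand, ← prod_range_range_eq
      (fun i j => p.eta (p.adv j u) - p.eta (p.adv i u)), phi, ← div_eq_inv_mul]
    simp only [Finset.prod_div_distrib]

end Params

end MultiRacah

/-! ### The three term recurrence of the (q-)Racah polynomials. -/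

namespace MultiRacah

variable {K : Type*} [Field K]

theorem Kind.poch_zero (κ : Kind K) (y : K) : κ.poch y 0 = 1 := by
  cases κ <;> simp [Kind.poch]

theorem Kind.poch_racah_succ (y : K) (k : ℕ) :
    Kind.racah.poch y (k + 1) = Kind.racah.poch y k * (y + k) := by
  simp [Kind.poch, Finset.prod_range_succ]

theorem Kind.poch_racah_succ' (y : K) (k : ℕ) :
    Kind.racah.poch y (k + 1) = y * Kind.racah.poch (y + 1) k := by
  simp only [Kind.poch, Finset.prod_range_succ']
  rw [mul_comm]
  congr 1
  · simp
  · exact Finset.prod_congr rfl fun i _ => by push_cast; ring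

theorem Kind.poch_qRacah_succ (q y : K) (k : ℕ) :
    (Kind.qRacah q).poch y (k + 1) = (Kind.qRacah q).poch y k * (1 - y * q ^ k) := by
  simp [Kind.poch, Finset.prod_range_succ]

theorem Kind.poch_qRacah_succ' (q y : K) (k : ℕ) :
    (Kind.qRacah q).poch y (k + 1) = (1 - y) * (Kind.qRacah q).poch (y * q) k := by
  simp only [Kind.poch, Finset.prod_range_succ']
  rw [mul_comm]
  congr 1
  · simp
  · exact Finset.prod_congr rfl fun i _ => by ring

theorem Kind.poch_ne_zero_of_le {κ : Kind K} {y : K} {k m : ℕ} (h : κ.poch y m ≠ 0) (hk : k ≤ m) :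
    κ.poch y k ≠ 0 := by
  cases κ <;>
  · refine Finset.prod_ne_zero_iff.2 fun i hi => ?_
    exact Finset.prod_ne_zero_iff.1 h i
      (Finset.mem_range.2 ((Finset.mem_range.1 hi).trans_le hk))

theorem Kind.add_ne_zero_of_poch {y : K} {i m : ℕ} (h : Kind.racah.poch y m ≠ 0) (hi : i < m) :
    y + (i : K) ≠ 0 :=
  Finset.prod_ne_zero_iff.1 h i (Finset.mem_range.2 hi)

theorem Kind.one_sub_ne_zero_of_poch {q y : K} {i m : ℕ} (h : (Kind.qRacah q).poch y m ≠ 0)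
    (hi : i < m) : 1 - y * q ^ i ≠ 0 :=
  Finset.prod_ne_zero_iff.1 h i (Finset.mem_range.2 hi)

/-- A three term relation between sums, from the relation between the coefficients. -/
theorem three_term_of_coeff {η A C : K} {Φ f g c c₁ c₂ : ℕ → K} {n : ℕ} (hg : g 0 = 0)
    (hΦ : ∀ k, η * Φ k = g k * Φ k - f k * Φ (k + 1)) (h0 : c₁ 0 = c 0) (h0' : c₂ 0 = c 0)
    (hn : c (n + 1) = 0)
    (h : ∀ j ≤ n, g (j + 1) * c (j + 1) - f j * c j
      = A * (c₁ (j + 1) - c (j + 1)) + C * (c₂ (j + 1) - c (j + 1))) :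
    η * ∑ k ∈ Finset.range (n + 2), c k * Φ k
      = A * ∑ k ∈ Finset.range (n + 2), c₁ k * Φ k
        + (-A - C) * ∑ k ∈ Finset.range (n + 2), c k * Φ k
        + C * ∑ k ∈ Finset.range (n + 2), c₂ k * Φ k := by
  have h1 : η * ∑ k ∈ Finset.range (n + 2), c k * Φ k
      = ∑ j ∈ Finset.range (n + 1), (g (j + 1) * c (j + 1) - f j * c j) * Φ (j + 1) := by
    have e1 : η * ∑ k ∈ Finset.range (n + 2), c k * Φ k
        = ∑ k ∈ Finset.range (n + 2), g k * c k * Φ k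
          - ∑ k ∈ Finset.range (n + 2), f k * c k * Φ (k + 1) := by
      rw [Finset.mul_sum, ← Finset.sum_sub_distrib]
      exact Finset.sum_congr rfl fun k _ => by linear_combination c k * hΦ k
    rw [e1, Finset.sum_range_succ', Finset.sum_range_succ _ (n + 1), hn, hg]
    simp only [mul_zero, zero_mul, add_zero, sub_mul, Finset.sum_sub_distrib]
  have h2 : A * ∑ k ∈ Finset.range (n + 2), c₁ k * Φ k
        + (-A - C) * ∑ k ∈ Finset.range (n + 2), c k * Φ k
        + C * ∑ k ∈ Finset.range (n + 2), c₂ k * Φ k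
      = ∑ k ∈ Finset.range (n + 2), (A * (c₁ k - c k) + C * (c₂ k - c k)) * Φ k := by
    simp only [Finset.mul_sum, ← Finset.sum_add_distrib]
    exact Finset.sum_congr rfl fun k _ => by ring
  rw [h1, h2, Finset.sum_range_succ' _ (n + 1), h0, h0']
  simp only [sub_self, mul_zero, add_zero, zero_mul]
  exact Finset.sum_congr rfl fun j hj => by
    rw [h j (Nat.lt_succ_iff.1 (Finset.mem_range.1 hj))]

/-- This is the coefficient of index j+1 in A_n (P_{n+1} - P_n). The difference of Pochhammer
symbols produces the factor 2n+1+d̃, which cancels against A_n; likewise 2n-1+d̃ cancels in C_n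
(P_{n-1} - P_n) in `racah_lower_identity`. What is left to compare is `racah_coeff_identity`. -/
theorem racah_upper_identity {N D a b c j X Z den : K} (h0 : 2 * N + D ≠ 0)
    (h1 : 2 * N + 1 + D ≠ 0) (hden : den ≠ 0) :
    (N + a) * (N + b) * (N + c) * (N + D) / ((2 * N + D) * (2 * N + 1 + D))
        * (-(N + 1) * X * (Z * (N + D + 1 + j)) / den - X * (-N + j) * ((N + D) * Z) / den)
      = -(j + 1) * (N + a) * (N + b) * (N + c) * X * ((N + D) * Z) / ((2 * N + D) * den) := by
  obtain ⟨s, hs⟩ : ∃ s, s = 2 * N + D := ⟨_, rfl⟩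
  obtain ⟨t, ht⟩ : ∃ t, t = 2 * N + 1 + D := ⟨_, rfl⟩
  rw [← hs] at h0 ⊢
  rw [← ht] at h1 ⊢
  field_simp
  rw [ht]
  ring

theorem racah_lower_identity {N D a b c j V Y den : K} (h0 : 2 * N + D ≠ 0)
    (h1 : 2 * N - 1 + D ≠ 0) (hden : den ≠ 0) :
    (N + D - a) * (N + D - b) * (N + D - c) * N / ((2 * N - 1 + D) * (2 * N + D))
        * (V * (-(N - 1) + j) * ((N - 1 + D) * Y) / den - -N * V * (Y * (N + D + j)) / den)
      = -(j + 1) * (N + D - a) * (N + D - b) * (N + D - c) * (-N * V) * Y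
        / ((2 * N + D) * den) := by
  obtain ⟨s, hs⟩ : ∃ s, s = 2 * N + D := ⟨_, rfl⟩
  obtain ⟨t, ht⟩ : ∃ t, t = 2 * N - 1 + D := ⟨_, rfl⟩
  rw [← hs] at h0 ⊢
  rw [← ht] at h1 ⊢
  field_simp
  rw [ht]
  ring

theorem racah_coeff_identity {N D a b c d j X Y den : K} (hd : d = a + b + c - 1 - D)
    (h0 : 2 * N + D ≠ 0) (hden : den ≠ 0) (ha : a + j ≠ 0) (hb : b + j ≠ 0) (hc : c + j ≠ 0)
    (hj : 1 + j ≠ 0) :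
    (j + 1) * (j + 1 + d) * (X * (-N + j) * (Y * (N + D + j))
          / (den * ((a + j) * (b + j) * (c + j) * (1 + j)))) - 1 * (X * Y / den)
      = -(j + 1) * (N + a) * (N + b) * (N + c) * X * (Y * (N + D + j))
          / ((2 * N + D) * (den * ((a + j) * (b + j) * (c + j) * (1 + j))))
        + -(j + 1) * (N + D - a) * (N + D - b) * (N + D - c) * (X * (-N + j)) * Y
          / ((2 * N + D) * (den * ((a + j) * (b + j) * (c + j) * (1 + j)))) := by
  obtain ⟨s, hs⟩ : ∃ s, s = 2 * N + D := ⟨_, rfl⟩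
  rw [← hs] at h0 ⊢
  field_simp
  rw [hs, hd]
  ring

theorem qRacah_upper_identity {q Q r D a b c X Z den : K} (hq : q ≠ 0) (hQ : Q ≠ 0)
    (h0 : 1 - D * Q ^ 2 ≠ 0) (h1 : 1 - D * (Q ^ 2 * q) ≠ 0) (hden : den ≠ 0) :
    (1 - a * Q) * (1 - b * Q) * (1 - c * Q) * (1 - D * Q) / ((1 - D * Q ^ 2) * (1 - D * (Q ^ 2 * q)))
        * ((1 - (Q * q)⁻¹) * X * (Z * (1 - D * Q * q * r)) / den * (r * q)
          - X * (1 - Q⁻¹ * r) * ((1 - D * Q) * Z) / den * (r * q))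
      = (r * q - 1) / (Q * q) * ((1 - a * Q) * (1 - b * Q) * (1 - c * Q)) * X * ((1 - D * Q) * Z)
        / ((1 - D * Q ^ 2) * den) * (r * q) := by
  obtain ⟨s, hs⟩ : ∃ x, x = 1 - D * Q ^ 2 := ⟨_, rfl⟩
  obtain ⟨t, ht⟩ : ∃ x, x = 1 - D * (Q ^ 2 * q) := ⟨_, rfl⟩
  rw [← hs] at h0 ⊢
  rw [← ht] at h1 ⊢
  field_simp
  rw [ht]
  ring

theorem qRacah_lower_identity {q Q r D a b c d V Y den : K} (hq : q ≠ 0) (hQ : Q ≠ 0)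
    (h0 : 1 - D * Q ^ 2 ≠ 0) (h1 : 1 - D * (Q ^ 2 / q) ≠ 0) (hden : den ≠ 0) :
    d * ((1 - a⁻¹ * D * Q) * (1 - b⁻¹ * D * Q) * (1 - c⁻¹ * D * Q) * (1 - Q))
          / ((1 - D * (Q ^ 2 / q)) * (1 - D * Q ^ 2))
        * (V * (1 - Q⁻¹ * q * r) * ((1 - D * (Q / q)) * Y) / den * (r * q)
          - (1 - Q⁻¹) * V * (Y * (1 - D * Q * r)) / den * (r * q))
      = -(1 - r * q) * d * ((1 - a⁻¹ * D * Q) * (1 - b⁻¹ * D * Q) * (1 - c⁻¹ * D * Q))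
        * ((1 - Q⁻¹) * V) * Y / ((1 - D * Q ^ 2) * den) * (r * q) := by
  generalize a⁻¹ = a', b⁻¹ = b', c⁻¹ = c'
  obtain ⟨s, hs⟩ : ∃ x, x = 1 - D * Q ^ 2 := ⟨_, rfl⟩
  obtain ⟨t, ht⟩ : ∃ x, x = 1 - D * (Q ^ 2 / q) := ⟨_, rfl⟩
  rw [← hs] at h0 ⊢
  rw [← ht] at h1 ⊢
  field_simp
  rw [ht]
  field_simp
  ring

theorem qRacah_coeff_identity {q Q r D a b c d X Y den : K} (hd : a * b * c = D * d * q)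
    (hq : q ≠ 0) (hQ : Q ≠ 0) (hr : r ≠ 0) (h0 : 1 - D * Q ^ 2 ≠ 0) (hden : den ≠ 0)
    (ha0 : a ≠ 0) (hb0 : b ≠ 0) (hc0 : c ≠ 0) (hD0 : D ≠ 0)
    (ha : 1 - a * r ≠ 0) (hb : 1 - b * r ≠ 0) (hc : 1 - c * r ≠ 0) (hj : 1 - q * r ≠ 0) :
    (r * q)⁻¹ * ((1 - r * q) * (1 - d * (r * q))) * (X * (1 - Q⁻¹ * r) * (Y * (1 - D * Q * r))
          / (den * ((1 - a * r) * (1 - b * r) * (1 - c * r) * (1 - q * r))) * (r * q))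
        - r⁻¹ * (X * Y / den * r)
      = (r * q - 1) / (Q * q) * ((1 - a * Q) * (1 - b * Q) * (1 - c * Q)) * X
          * (Y * (1 - D * Q * r)) / ((1 - D * Q ^ 2)
            * (den * ((1 - a * r) * (1 - b * r) * (1 - c * r) * (1 - q * r)))) * (r * q)
        + -(1 - r * q) * d * ((1 - a⁻¹ * D * Q) * (1 - b⁻¹ * D * Q) * (1 - c⁻¹ * D * Q))
          * (X * (1 - Q⁻¹ * r)) * Y / ((1 - D * Q ^ 2)
            * (den * ((1 - a * r) * (1 - b * r) * (1 - c * r) * (1 - q * r)))) * (r * q) := by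
  obtain rfl : d = a * b * c / (D * q) := by
    rw [eq_div_iff (mul_ne_zero hD0 hq), hd]; ring
  obtain ⟨s, hs⟩ : ∃ x, x = 1 - D * Q ^ 2 := ⟨_, rfl⟩
  obtain ⟨ta, hta⟩ : ∃ x, x = 1 - a * r := ⟨_, rfl⟩
  obtain ⟨tb, htb⟩ : ∃ x, x = 1 - b * r := ⟨_, rfl⟩
  obtain ⟨tc, htc⟩ : ∃ x, x = 1 - c * r := ⟨_, rfl⟩
  obtain ⟨tj, htj⟩ : ∃ x, x = 1 - q * r := ⟨_, rfl⟩
  rw [← hs] at h0 ⊢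
  rw [← hta] at ha ⊢
  rw [← htb] at hb ⊢
  rw [← htc] at hc ⊢
  rw [← htj] at hj ⊢
  field_simp
  rw [hs, hta, htb, htc, htj]
  ring

namespace Params

theorem A_neg_one (p : Params K) : p.A (-1) = 0 := by simp [A]

theorem C_zero (p : Params K) : p.C 0 = 0 := by
  obtain ⟨_ | q, a, b, c, d⟩ := p <;> simp [C]

/-- The coefficients of the hypergeometric sum, as functions of `n`, resp. `q ^ n`. -/
def hypCoeff (p : Params K) (N : K) (k : ℕ) : K :=
  match p.kind with
  | .racah => p.kind.poch (-N) k * p.kind.poch (N + p.dt) k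
      / (p.kind.poch p.a k * p.kind.poch p.b k * p.kind.poch p.c k * p.kind.poch 1 k)
  | .qRacah q => p.kind.poch N⁻¹ k * p.kind.poch (p.dt * N) k
      / (p.kind.poch p.a k * p.kind.poch p.b k * p.kind.poch p.c k * p.kind.poch q k) * q ^ k

/-- The basis functions of the hypergeometric sum. -/
def hypBasis (p : Params K) (u : K) (k : ℕ) : K :=
  match p.kind with
  | .racah => p.kind.poch (-u) k * p.kind.poch (u + p.d) k
  | .qRacah _ => p.kind.poch u⁻¹ k * p.kind.poch (p.d * u) k

/-- `n`, resp. `q ^ n`. -/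
def index (p : Params K) (n : ℕ) : K :=
  match p.kind with
  | .racah => (n : K)
  | .qRacah q => q ^ n

variable {p : Params K} {u : K}

theorem hypCoeff_eq_zero (hp : p.Nondeg) {n k : ℕ} (h : n < k) : p.hypCoeff (p.index n) k = 0 := by
  obtain ⟨_ | q, a, b, c, d⟩ := p
  · have : Kind.racah.poch (-(n : K)) k = 0 :=
      Finset.prod_eq_zero (Finset.mem_range.2 h) (by simp)
    simp [hypCoeff, index, this]
  · have : (Kind.qRacah q).poch ((q ^ n)⁻¹) k = 0 :=
      Finset.prod_eq_zero (Finset.mem_range.2 h)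
        (by rw [inv_mul_cancel₀ (pow_ne_zero _ hp.1), sub_self])
    simp [hypCoeff, index, this]

/-- The coefficients vanish beyond n, so P_{n-1}, P_n and P_{n+1} can be summed over one common
range. -/
theorem cP_eq_sum (hp : p.Nondeg) {n N : ℕ} (h : n < N) (u : K) :
    p.cP n u = ∑ k ∈ Finset.range N, p.hypCoeff (p.index n) k * p.hypBasis u k := by
  have h1 : p.cP n u
      = ∑ k ∈ Finset.range (n + 1), p.hypCoeff (p.index n) k * p.hypBasis u k := by
    obtain ⟨_ | q, a, b, c, d⟩ := p
    · simp only [cP, hypCoeff, hypBasis, index]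
      exact Finset.sum_congr rfl fun k _ => by ring
    · simp only [cP, hypCoeff, hypBasis, index]
      exact Finset.sum_congr rfl fun k _ => by ring
  rw [h1]
  refine Finset.sum_subset (Finset.range_mono h) fun k _ hk => ?_
  rw [hypCoeff_eq_zero hp (by simpa using hk), zero_mul]

theorem three_term_racah [CharZero K] {a b c d : K} {n : ℕ}
    (ha : Kind.racah.poch a (n + 1) ≠ 0) (hb : Kind.racah.poch b (n + 1) ≠ 0)
    (hc : Kind.racah.poch c (n + 1) ≠ 0)
    (hd : Kind.racah.poch (dt ⟨.racah, a, b, c, d⟩) (2 * n + 2) ≠ 0) (u : K) :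
    eta ⟨.racah, a, b, c, d⟩ u * cP ⟨.racah, a, b, c, d⟩ n u
      = A ⟨.racah, a, b, c, d⟩ n * cP ⟨.racah, a, b, c, d⟩ (n + 1) u
        + B ⟨.racah, a, b, c, d⟩ n * cP ⟨.racah, a, b, c, d⟩ n u
        + C ⟨.racah, a, b, c, d⟩ n * cP ⟨.racah, a, b, c, d⟩ (n - 1) u := by
  have hp : Nondeg ⟨.racah, a, b, c, d⟩ := trivial
  rw [cP_eq_sum hp (show n < n + 2 by omega), cP_eq_sum hp (show n + 1 < n + 2 by omega),
    cP_eq_sum hp (show n - 1 < n + 2 by omega), B]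
  -- These come from η(x) = k(k+d) - (-x+k)(x+d+k): multiplication by η is bidiagonal in the
  -- hypergeometric basis.
  refine three_term_of_coeff (f := fun _ => 1) (g := fun k => (k : K) * (k + d)) (by simp)
    (fun k => ?_) (by simp [hypCoeff, Kind.poch_zero]) (by simp [hypCoeff, Kind.poch_zero])
    (hypCoeff_eq_zero hp (Nat.lt_succ_self n)) (fun j hj => ?_)
  · simp only [eta, hypBasis, Kind.poch_racah_succ]
    ring
  have hD : d = a + b + c - 1 - dt ⟨.racah, a, b, c, d⟩ := by simp only [dt]; ring
  have hA : A ⟨.racah, a, b, c, d⟩ n = ((n : K) + a) * (n + b) * (n + c)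
      * (n + dt ⟨.racah, a, b, c, d⟩) / ((2 * n + dt ⟨.racah, a, b, c, d⟩)
        * (2 * n + 1 + dt ⟨.racah, a, b, c, d⟩)) := by
    have : (n : ℤ) ≠ -1 := by omega
    simp [A, this]
  have hC : C ⟨.racah, a, b, c, d⟩ n = ((n : K) + dt ⟨.racah, a, b, c, d⟩ - a)
      * (n + dt ⟨.racah, a, b, c, d⟩ - b) * (n + dt ⟨.racah, a, b, c, d⟩ - c) * n
      / ((2 * n - 1 + dt ⟨.racah, a, b, c, d⟩) * (2 * n + dt ⟨.racah, a, b, c, d⟩)) := by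
    simp [C]
  simp only [hypCoeff, index]
  generalize dt ⟨.racah, a, b, c, d⟩ = D at *
  have d0 : 2 * (n : K) + D ≠ 0 := by
    have := Kind.add_ne_zero_of_poch hd (show 2 * n < 2 * n + 2 by omega)
    push_cast at this; rwa [add_comm]
  have d1 : 2 * (n : K) + 1 + D ≠ 0 := by
    have := Kind.add_ne_zero_of_poch hd (show 2 * n + 1 < 2 * n + 2 by omega)
    push_cast at this; rwa [add_comm]
  have ha' := Kind.add_ne_zero_of_poch ha (show j < n + 1 by omega)
  have hb' := Kind.add_ne_zero_of_poch hb (show j < n + 1 by omega)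
  have hc' := Kind.add_ne_zero_of_poch hc (show j < n + 1 by omega)
  have h1' : (1 : K) + j ≠ 0 := by rw [add_comm]; exact Nat.cast_add_one_ne_zero j
  have hden : Kind.racah.poch a j * Kind.racah.poch b j * Kind.racah.poch c j
      * Kind.racah.poch 1 j ≠ 0 := mul_ne_zero (mul_ne_zero (mul_ne_zero
    (Kind.poch_ne_zero_of_le ha (by omega)) (Kind.poch_ne_zero_of_le hb (by omega)))
    (Kind.poch_ne_zero_of_le hc (by omega)))
    (Finset.prod_ne_zero_iff.2 fun i _ => by rw [add_comm]; exact Nat.cast_add_one_ne_zero i)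
  have hden' : Kind.racah.poch a (j + 1) * Kind.racah.poch b (j + 1) * Kind.racah.poch c (j + 1)
      * Kind.racah.poch 1 (j + 1) = Kind.racah.poch a j * Kind.racah.poch b j
        * Kind.racah.poch c j * Kind.racah.poch 1 j * ((a + j) * (b + j) * (c + j) * (1 + j)) := by
    simp only [Kind.poch_racah_succ]
    ring
  rw [hden']
  have hden1 := mul_ne_zero hden (mul_ne_zero (mul_ne_zero (mul_ne_zero ha' hb') hc') h1')
  have hY : ((n : K) + D) * Kind.racah.poch ((n : K) + D + 1) j
      = Kind.racah.poch ((n : K) + D) j * (n + D + j) := by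
    rw [← Kind.poch_racah_succ', Kind.poch_racah_succ]
  have hX : -(n : K) * Kind.racah.poch (-(n : K) + 1) j
      = Kind.racah.poch (-(n : K)) j * (-n + j) := by
    rw [← Kind.poch_racah_succ', Kind.poch_racah_succ]
  have key := racah_coeff_identity (N := (n : K)) (X := Kind.racah.poch (-(n : K)) j)
    (Y := Kind.racah.poch ((n : K) + D) j) hD d0 hden ha' hb' hc' h1'
  have e1 := racah_upper_identity (a := a) (b := b) (c := c) (j := (j : K))
    (X := Kind.racah.poch (-(n : K)) j) (Z := Kind.racah.poch ((n : K) + D + 1) j) d0 d1 hden1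
  rw [← hA, hY] at e1
  have e2 : C ⟨.racah, a, b, c, d⟩ n
        * (Kind.racah.poch (-((n - 1 : ℕ) : K)) (j + 1)
            * Kind.racah.poch (((n - 1 : ℕ) : K) + D) (j + 1)
              / (Kind.racah.poch a j * Kind.racah.poch b j
        * Kind.racah.poch c j * Kind.racah.poch 1 j * ((a + j) * (b + j) * (c + j) * (1 + j)))
          - Kind.racah.poch (-(n : K)) j * (-n + j) * (Kind.racah.poch ((n : K) + D) j * (n + D + j))
              / (Kind.racah.poch a j * Kind.racah.poch b j
        * Kind.racah.poch c j * Kind.racah.poch 1 j * ((a + j) * (b + j) * (c + j) * (1 + j))))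
      = -(j + 1) * (n + D - a) * (n + D - b) * (n + D - c) * (Kind.racah.poch (-(n : K)) j * (-n + j))
        * Kind.racah.poch ((n : K) + D) j / ((2 * n + D) * (Kind.racah.poch a j * Kind.racah.poch b j
        * Kind.racah.poch c j * Kind.racah.poch 1 j * ((a + j) * (b + j) * (c + j) * (1 + j)))) := by
    -- For n = 0 the truncated index n - 1 is 0 and the denominator 2n-1+d̃ is not controlled, but
    -- C_0 = 0 removes the term.
    rcases n with _ | n
    · rw [← hX, Int.ofNat_zero, C_zero]
      simp
    have d2 : 2 * ((n + 1 : ℕ) : K) - 1 + D ≠ 0 := by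
      have := Kind.add_ne_zero_of_poch hd (show 2 * n + 1 < 2 * (n + 1) + 2 by omega)
      push_cast at this ⊢
      convert this using 1; ring
    have e2 := racah_lower_identity (a := a) (b := b) (c := c) (j := (j : K))
      (V := Kind.racah.poch (-((n + 1 : ℕ) : K) + 1) j)
      (Y := Kind.racah.poch (((n + 1 : ℕ) : K) + D) j) d0 d2 hden1
    rw [← hC, hX] at e2
    rw [← e2, Nat.add_sub_cancel, Kind.poch_racah_succ (-(n : K)),
      Kind.poch_racah_succ' ((n : K) + D),
      show -((n + 1 : ℕ) : K) + 1 = -(n : K) by push_cast; ring,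
      show ((n + 1 : ℕ) : K) + D = n + D + 1 by push_cast; ring]
    push_cast
    simp only [add_sub_cancel_right]
  rw [← e1, ← e2] at key
  rw [Kind.poch_racah_succ' (-((n + 1 : ℕ) : K)), Kind.poch_racah_succ (((n + 1 : ℕ) : K) + D),
    Kind.poch_racah_succ (-(n : K)), Kind.poch_racah_succ ((n : K) + D),
    show -((n + 1 : ℕ) : K) + 1 = -(n : K) by push_cast; ring,
    show ((n + 1 : ℕ) : K) + D = n + D + 1 by push_cast; ring]
  push_cast
  exact key

theorem three_term_qRacah {q a b c d : K} (hp : Nondeg ⟨.qRacah q, a, b, c, d⟩) {n : ℕ}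
    (ha : (Kind.qRacah q).poch a (n + 1) ≠ 0) (hb : (Kind.qRacah q).poch b (n + 1) ≠ 0)
    (hc : (Kind.qRacah q).poch c (n + 1) ≠ 0)
    (hd : (Kind.qRacah q).poch (dt ⟨.qRacah q, a, b, c, d⟩) (2 * n + 2) ≠ 0) {u : K}
    (hu : u ≠ 0) :
    eta ⟨.qRacah q, a, b, c, d⟩ u * cP ⟨.qRacah q, a, b, c, d⟩ n u
      = A ⟨.qRacah q, a, b, c, d⟩ n * cP ⟨.qRacah q, a, b, c, d⟩ (n + 1) u
        + B ⟨.qRacah q, a, b, c, d⟩ n * cP ⟨.qRacah q, a, b, c, d⟩ n u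
        + C ⟨.qRacah q, a, b, c, d⟩ n * cP ⟨.qRacah q, a, b, c, d⟩ (n - 1) u := by
  rw [cP_eq_sum hp (show n < n + 2 by omega), cP_eq_sum hp (show n + 1 < n + 2 by omega),
    cP_eq_sum hp (show n - 1 < n + 2 by omega), B]
  obtain ⟨hq, hq1, ha0, hb0, hc0, hd0⟩ := id hp
  simp only at ha0 hb0 hc0 hd0
  refine three_term_of_coeff (f := fun k => (q ^ k)⁻¹)
    (g := fun k => (q ^ k)⁻¹ * ((1 - q ^ k) * (1 - d * q ^ k))) (by simp)
    (fun k => ?_) (by simp [hypCoeff, Kind.poch_zero]) (by simp [hypCoeff, Kind.poch_zero])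
    (hypCoeff_eq_zero hp (Nat.lt_succ_self n)) (fun j hj => ?_)
  · simp only [eta, hypBasis, Kind.poch_qRacah_succ]
    field_simp
    ring
  have hD : a * b * c = dt ⟨.qRacah q, a, b, c, d⟩ * d * q := by simp only [dt]; field_simp
  have hD0 : dt ⟨.qRacah q, a, b, c, d⟩ ≠ 0 := by
    simp [dt, ha0, hb0, hc0, hd0, hq]
  have z0 : q ^ (2 * (n : ℤ)) = (q ^ n) ^ 2 := by
    rw [← pow_mul, ← zpow_natCast]; congr 1; push_cast; ring
  have z1 : q ^ (2 * (n : ℤ) + 1) = (q ^ n) ^ 2 * q := by rw [zpow_add_one₀ hq, z0]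
  have z2 : q ^ (2 * (n : ℤ) - 1) = (q ^ n) ^ 2 / q := by
    rw [zpow_sub_one₀ hq, z0, div_eq_mul_inv]
  have hA : A ⟨.qRacah q, a, b, c, d⟩ n = (1 - a * q ^ n) * (1 - b * q ^ n) * (1 - c * q ^ n)
      * (1 - dt ⟨.qRacah q, a, b, c, d⟩ * q ^ n) / ((1 - dt ⟨.qRacah q, a, b, c, d⟩ * (q ^ n) ^ 2)
        * (1 - dt ⟨.qRacah q, a, b, c, d⟩ * ((q ^ n) ^ 2 * q))) := by
    have : (n : ℤ) ≠ -1 := by omega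
    simp only [A, this, if_false, z0, z1, zpow_natCast]
  have hC : C ⟨.qRacah q, a, b, c, d⟩ n = d * ((1 - a⁻¹ * dt ⟨.qRacah q, a, b, c, d⟩ * q ^ n)
      * (1 - b⁻¹ * dt ⟨.qRacah q, a, b, c, d⟩ * q ^ n)
      * (1 - c⁻¹ * dt ⟨.qRacah q, a, b, c, d⟩ * q ^ n) * (1 - q ^ n))
      / ((1 - dt ⟨.qRacah q, a, b, c, d⟩ * ((q ^ n) ^ 2 / q))
        * (1 - dt ⟨.qRacah q, a, b, c, d⟩ * (q ^ n) ^ 2)) := by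
    simp only [C, z0, z2, zpow_natCast]
  simp only [hypCoeff, index]
  generalize dt ⟨.qRacah q, a, b, c, d⟩ = D at *
  have hQ : q ^ n ≠ 0 := pow_ne_zero _ hq
  have hr : q ^ j ≠ 0 := pow_ne_zero _ hq
  have d0 : 1 - D * (q ^ n) ^ 2 ≠ 0 := by
    have := Kind.one_sub_ne_zero_of_poch hd (show n * 2 < 2 * n + 2 by omega)
    rwa [pow_mul] at this
  have d1 : 1 - D * ((q ^ n) ^ 2 * q) ≠ 0 := by
    have := Kind.one_sub_ne_zero_of_poch hd (show n * 2 + 1 < 2 * n + 2 by omega)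
    rwa [pow_succ, pow_mul] at this
  have ha' := Kind.one_sub_ne_zero_of_poch ha (show j < n + 1 by omega)
  have hb' := Kind.one_sub_ne_zero_of_poch hb (show j < n + 1 by omega)
  have hc' := Kind.one_sub_ne_zero_of_poch hc (show j < n + 1 by omega)
  have h1 : ∀ i : ℕ, 1 - q * q ^ i ≠ 0 := fun i => by
    rw [← pow_succ']; exact sub_ne_zero.2 (hq1 (i + 1) (by omega)).symm
  have h1' := h1 j
  obtain ⟨den, hden_def⟩ : ∃ x, x = (Kind.qRacah q).poch a j * (Kind.qRacah q).poch b j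
      * (Kind.qRacah q).poch c j * (Kind.qRacah q).poch q j := ⟨_, rfl⟩
  have hden : den ≠ 0 := hden_def ▸ mul_ne_zero (mul_ne_zero (mul_ne_zero
    (Kind.poch_ne_zero_of_le ha (by omega)) (Kind.poch_ne_zero_of_le hb (by omega)))
    (Kind.poch_ne_zero_of_le hc (by omega)))
    (Finset.prod_ne_zero_iff.2 fun i _ => h1 i)
  have hden' : (Kind.qRacah q).poch a (j + 1) * (Kind.qRacah q).poch b (j + 1)
      * (Kind.qRacah q).poch c (j + 1) * (Kind.qRacah q).poch q (j + 1)
      = den * ((1 - a * q ^ j) * (1 - b * q ^ j) * (1 - c * q ^ j) * (1 - q * q ^ j)) := by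
    simp only [Kind.poch_qRacah_succ, hden_def]
    ring
  rw [hden', ← hden_def]
  have hden1 := mul_ne_zero hden (mul_ne_zero (mul_ne_zero (mul_ne_zero ha' hb') hc') h1')
  have hY : (1 - D * q ^ n) * (Kind.qRacah q).poch (D * q ^ n * q) j
      = (Kind.qRacah q).poch (D * q ^ n) j * (1 - D * q ^ n * q ^ j) := by
    rw [← Kind.poch_qRacah_succ', Kind.poch_qRacah_succ]
  have hX : (1 - (q ^ n)⁻¹) * (Kind.qRacah q).poch ((q ^ n)⁻¹ * q) j
      = (Kind.qRacah q).poch ((q ^ n)⁻¹) j * (1 - (q ^ n)⁻¹ * q ^ j) := by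
    rw [← Kind.poch_qRacah_succ', Kind.poch_qRacah_succ]
  have key := qRacah_coeff_identity (X := (Kind.qRacah q).poch ((q ^ n)⁻¹) j)
    (Y := (Kind.qRacah q).poch (D * q ^ n) j) hD hq hQ hr d0 hden ha0 hb0 hc0 hD0 ha' hb' hc' h1'
  have e1 := qRacah_upper_identity (r := q ^ j) (a := a) (b := b) (c := c)
    (X := (Kind.qRacah q).poch ((q ^ n)⁻¹) j)
    (Z := (Kind.qRacah q).poch (D * q ^ n * q) j) hq hQ d0 d1 hden1
  rw [← hA, hY] at e1
  have e2 : C ⟨.qRacah q, a, b, c, d⟩ n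
        * ((Kind.qRacah q).poch ((q ^ (n - 1))⁻¹) (j + 1)
            * (Kind.qRacah q).poch (D * q ^ (n - 1)) (j + 1)
              / (den * ((1 - a * q ^ j) * (1 - b * q ^ j) * (1 - c * q ^ j) * (1 - q * q ^ j)))
              * (q ^ j * q)
          - (Kind.qRacah q).poch ((q ^ n)⁻¹) j * (1 - (q ^ n)⁻¹ * q ^ j)
            * ((Kind.qRacah q).poch (D * q ^ n) j * (1 - D * q ^ n * q ^ j))
              / (den * ((1 - a * q ^ j) * (1 - b * q ^ j) * (1 - c * q ^ j) * (1 - q * q ^ j)))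
              * (q ^ j * q))
      = -(1 - q ^ j * q) * d * ((1 - a⁻¹ * D * q ^ n) * (1 - b⁻¹ * D * q ^ n)
          * (1 - c⁻¹ * D * q ^ n))
        * ((Kind.qRacah q).poch ((q ^ n)⁻¹) j * (1 - (q ^ n)⁻¹ * q ^ j))
        * (Kind.qRacah q).poch (D * q ^ n) j / ((1 - D * (q ^ n) ^ 2)
          * (den * ((1 - a * q ^ j) * (1 - b * q ^ j) * (1 - c * q ^ j) * (1 - q * q ^ j))))
        * (q ^ j * q) := by
    rcases n with _ | n
    · rw [← hX, Int.ofNat_zero, C_zero]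
      simp
    have d2 : 1 - D * ((q ^ (n + 1)) ^ 2 / q) ≠ 0 := by
      have := Kind.one_sub_ne_zero_of_poch hd (show 2 * n + 1 < 2 * (n + 1) + 2 by omega)
      convert this using 2
      field_simp
      ring
    have e2 := qRacah_lower_identity (r := q ^ j) (a := a) (b := b) (c := c) (d := d)
      (V := (Kind.qRacah q).poch ((q ^ (n + 1))⁻¹ * q) j)
      (Y := (Kind.qRacah q).poch (D * q ^ (n + 1)) j) hq hQ d0 d2 hden1
    rw [← hC, hX] at e2
    rw [← e2, Nat.add_sub_cancel, Kind.poch_qRacah_succ q ((q ^ n)⁻¹),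
      Kind.poch_qRacah_succ' q (D * q ^ n),
      show (q ^ (n + 1))⁻¹ * q = (q ^ n)⁻¹ by rw [pow_succ]; field_simp,
      show q ^ (n + 1) / q = q ^ n by rw [pow_succ]; field_simp, pow_succ q n, mul_assoc D]
  rw [← e1, ← e2] at key
  rw [Kind.poch_qRacah_succ' q ((q ^ (n + 1))⁻¹), Kind.poch_qRacah_succ q (D * q ^ (n + 1)),
    Kind.poch_qRacah_succ q ((q ^ n)⁻¹), Kind.poch_qRacah_succ q (D * q ^ n),
    show (q ^ (n + 1))⁻¹ * q = (q ^ n)⁻¹ by rw [pow_succ]; field_simp, pow_succ q n, pow_succ q j,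
    ← mul_assoc D]
  exact key

/-- The three term recurrence relation of the (`q`-)Racah polynomials. -/
theorem eta_mul_cP [CharZero K] (hp : p.Nondeg) {n : ℕ} (ha : p.kind.poch p.a (n + 1) ≠ 0)
    (hb : p.kind.poch p.b (n + 1) ≠ 0) (hc : p.kind.poch p.c (n + 1) ≠ 0)
    (hd : p.kind.poch p.dt (2 * n + 2) ≠ 0) (hu : p.IsPoint u) :
    p.eta u * p.cP n u
      = p.A n * p.cP (n + 1) u + p.B n * p.cP n u + p.C n * p.cP (n - 1) u := by
  obtain ⟨_ | q, a, b, c, d⟩ := p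
  · exact three_term_racah ha hb hc hd u
  · exact three_term_qRacah hp ha hb hc hd hu

end Params

end MultiRacah

/-! ### Divisibility of the determinant and existence of the multi-indexed polynomials. -/

namespace MultiRacah

/-- The divided difference on nodes i, …, i+j is κ_0⋯κ_{j-1} · F_0⋯F_{i-1} · G_{i+j}⋯G_{M-1}.
Passing from i to i+1 replaces G_{i+j} by F_i, and `h` turns this change into κ_j times the
difference of nodes. -/
theorem exists_interpolant_prod {R : Type*} [CommRing R] {F G v κ : ℕ → R} {M : ℕ}
    (h : ∀ j i, i + j + 1 ≤ M → F i - G (i + j) = κ j * (v (i + j + 1) - v i)) :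
    ∃ ρ : R[X], ∀ i ≤ M, ρ.eval (v i)
      = (∏ l ∈ Finset.range i, F l) * ∏ l ∈ Finset.range (M - i), G (i + l) := by
  obtain ⟨ρ, hρ⟩ := exists_interpolant (R := R) (v := v) (M := M)
    (g := fun j i => (∏ l ∈ Finset.range j, κ l) * ((∏ l ∈ Finset.range i, F l)
      * ∏ l ∈ Finset.range (M - (i + j)), G (i + j + l))) (fun j i hij => by
    obtain ⟨k, rfl⟩ := Nat.exists_eq_add_of_le hij
    have e1 : i + j + 1 + k - (i + 1 + j) = k := by omega
    have e2 : i + j + 1 + k - (i + j) = k + 1 := by omega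
    have e3 : i + j + 1 + k - (i + (j + 1)) = k := by omega
    have e4 : ∀ l, G (i + j + (l + 1)) = G (i + 1 + j + l) := fun l => by congr 1; ring
    have e5 : ∀ l, G (i + (j + 1) + l) = G (i + 1 + j + l) := fun l => by congr 1; ring
    simp only [e1, e2, e3, Finset.prod_range_succ _ i, Finset.prod_range_succ _ j,
      Finset.prod_range_succ' _ k, e4, e5, add_zero]
    linear_combination (∏ l ∈ Finset.range j, κ l) * (∏ l ∈ Finset.range i, F l)
      * (∏ l ∈ Finset.range k, G (i + 1 + j + l)) * h j i hij)
  exact ⟨ρ, fun i hi => by simpa using hρ i hi⟩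

namespace Params

variable {K : Type*} [Field K] {p : Params K} {u : K} {M : ℕ}

/-- The matrix in the definition of the multi-indexed polynomials. -/
def detMatrix (p : Params K) (D : Fin M → ℕ) (n : ℕ) (u : K) :
    Matrix (Fin (M + 1)) (Fin (M + 1)) K :=
  Matrix.of fun i j => Fin.snoc (α := fun _ => K) (fun k : Fin M => p.cXi (D k) (p.adv (i : ℕ) u))
    (p.r M (i : ℕ) u * p.cP n (p.adv (i : ℕ) u)) j

/-- This makes the last column of the determinant polynomial in the nodes η(x+i), as the virtual
state columns already are. The coefficients of ρ are themselves functions of x. -/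
theorem exists_r_interpolant [CharZero K] (hp : p.Nondeg) (M : ℕ) :
    ∃ ρ : (p.coordAlg M)[X], ∀ i ≤ M, ∀ u : {u // p.IsPoint u},
      (ρ.eval ⟨_, eta_adv_mem_coordAlg hp i⟩ : p.coordAlg M).1 u = p.r M i u := by
  obtain ⟨ν, hν⟩ := exists_r_eq hp M
  choose κ hκ using fun j => exists_facF_sub_facG hp j
  obtain ⟨ρ, hρ⟩ := exists_interpolant_prod (R := p.coordAlg M) (M := M)
    (F := fun i => ⟨_, facF_adv_mem_coordAlg hp i⟩) (G := fun i => ⟨_, facG_adv_mem_coordAlg hp i⟩)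
    (v := fun i => ⟨_, eta_adv_mem_coordAlg hp i⟩) (κ := fun j => algebraMap K _ (κ j))
    (fun j i _ => by
      ext u
      have := hκ j (p.adv i u) (isPoint_adv hp u.2 i)
      rw [adv_adv, adv_adv, ← add_assoc] at this
      exact this)
  refine ⟨Polynomial.C (algebraMap K _ ν) * ρ, fun i hi u => ?_⟩
  rw [eval_mul, eval_C, hρ i hi, hν u i hi]
  simp [Finset.prod_apply]

/-- The division by the Vandermonde product takes place in `coordAlg`, so the quotient is again
generated by the coordinate and its reflection. Evaluation at a point then gives the scalar
identity. -/
theorem exists_det_eq [CharZero K] (hp : p.Nondeg) (D : Fin M → ℕ) (n : ℕ) :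
    ∃ f ∈ p.coordAlg M, ∀ u : {u // p.IsPoint u},
      (p.detMatrix D n u).det = p.etaVand (M + 1) u * f u := by
  obtain ⟨ρ, hρ⟩ := exists_r_interpolant hp M
  obtain ⟨P, hP⟩ := exists_cP_eq_eval hp n
  choose Ξ hΞ using fun v => exists_cXi_eq_eval hp v
  let v : Fin (M + 1) → p.coordAlg M := fun i => ⟨_, eta_adv_mem_coordAlg hp i⟩
  let Q : Fin (M + 1) → (p.coordAlg M)[X] := fun j =>
    Fin.snoc (α := fun _ => (p.coordAlg M)[X])
      (fun k : Fin M => (Ξ (D k)).map (algebraMap K (p.coordAlg M)))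
      (ρ * P.map (algebraMap K (p.coordAlg M))) j
  obtain ⟨f, hf⟩ := vandermonde_dvd_det_eval v Q
  refine ⟨f.1, f.2, fun u => ?_⟩
  let ev : p.coordAlg M →ₐ[K] K := (Pi.evalAlgHom K (fun _ => K) u).comp (p.coordAlg M).val
  have hev : ∀ i (T : K[X]), ev ((T.map (algebraMap K (p.coordAlg M))).eval (v i))
      = T.eval (p.eta (p.adv (i : ℕ) u)) := fun i T => by
    rw [eval_map_algebraMap, ← Polynomial.aeval_algHom_apply, Polynomial.aeval_def]
    simp only [Algebra.algebraMap_self, eval₂_id]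
    rfl
  have h := congrArg ev hf
  rw [map_mul, AlgHom.map_det] at h
  convert h using 2
  · ext i j
    refine Fin.lastCases ?_ (fun k => ?_) j
    · simp only [detMatrix, Matrix.of_apply, Fin.snoc_last, AlgHom.mapMatrix_apply,
        Matrix.map_apply, Q, eval_mul, map_mul, hev]
      rw [hP _ (isPoint_adv hp u.2 i), ← hρ i (Nat.lt_succ_iff.1 i.2) u]
      rfl
    · simp only [detMatrix, Matrix.of_apply, Fin.snoc_castSucc, AlgHom.mapMatrix_apply,
        Matrix.map_apply, Q, hev]
      exact hΞ _ _ (isPoint_adv hp u.2 i)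
  · simp only [etaVand, map_prod, map_sub]
    rfl
  · rfl

theorem r_refl (hp : p.Nondeg) (hu : p.IsPoint u) {i : ℕ} (hi : i ≤ M) :
    p.r M i (p.refl M u) = p.r M (M - i) u := by
  obtain ⟨ν, hν⟩ := exists_r_eq hp M
  rw [hν _ i hi, hν _ (M - i) (Nat.sub_le _ _)]
  obtain ⟨k, rfl⟩ := Nat.exists_eq_add_of_le hi
  rw [Nat.add_sub_cancel_left, Nat.add_sub_cancel, mul_comm (∏ l ∈ Finset.range k, _)]
  congr 2
  · rw [← Finset.prod_range_reflect]
    refine Finset.prod_congr rfl fun l hl => ?_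
    obtain ⟨m, rfl⟩ := Nat.exists_eq_add_of_lt (Finset.mem_range.1 hl)
    rw [show l + m + 1 - 1 - l = m by omega, show l + m + 1 + k = m + (k + l) + 1 by ring]
    exact facF_adv_refl hp hu
  · rw [← Finset.prod_range_reflect]
    refine Finset.prod_congr rfl fun l hl => ?_
    obtain ⟨m, rfl⟩ := Nat.exists_eq_add_of_lt (Finset.mem_range.1 hl)
    rw [show l + m + 1 - 1 - l = m by omega, show i + (l + m + 1) = (i + m) + l + 1 by ring]
    exact facG_adv_refl hp hu

theorem detMatrix_refl (hp : p.Nondeg) (hu : p.IsPoint u) (D : Fin M → ℕ) (n : ℕ) :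
    p.detMatrix D n (p.refl M u) = (p.detMatrix D n u).submatrix Fin.revPerm id := by
  ext i j
  have hi : (i : ℕ) ≤ M := Nat.lt_succ_iff.1 i.2
  have hrev : ((Fin.rev i : Fin (M + 1)) : ℕ) = M - i := by simp [Fin.val_rev]
  have h1 := isPoint_adv hp (isPoint_refl hp hu M) i
  have h2 := isPoint_adv hp hu (M - i)
  refine Fin.lastCases ?_ (fun k => ?_) j
  · obtain ⟨P, hP⟩ := exists_cP_eq_eval hp n
    simp only [detMatrix, Matrix.of_apply, Fin.snoc_last, Matrix.submatrix_apply, id,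
      Fin.revPerm_apply, hrev]
    rw [hP _ h1, hP _ h2, eta_adv_refl hp hu hi, r_refl hp hu hi]
  · obtain ⟨P, hP⟩ := exists_cXi_eq_eval hp (D k)
    simp only [detMatrix, Matrix.of_apply, Fin.snoc_castSucc, Matrix.submatrix_apply, id,
      Fin.revPerm_apply, hrev]
    rw [hP _ h1, hP _ h2, eta_adv_refl hp hu hi]

/-- The sign is the one by which the determinant changes when its rows are reversed
(`detMatrix_refl`), so the quotient of the two is invariant. -/
theorem etaVand_refl (hp : p.Nondeg) (hu : p.IsPoint u) :
    p.etaVand (M + 1) (p.refl M u)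
      = (Equiv.Perm.sign (Fin.revPerm (n := M + 1)) : ℤ) * p.etaVand (M + 1) u := by
  have h : ∀ u, p.etaVand (M + 1) u
      = (Matrix.vandermonde fun i : Fin (M + 1) => p.eta (p.adv (i : ℕ) u)).det := fun u =>
    (Matrix.det_vandermonde _).symm
  rw [h, h, ← Matrix.det_permute]
  congr 1
  ext i j
  have hi : (i : ℕ) ≤ M := Nat.lt_succ_iff.1 i.2
  simp [Matrix.vandermonde_apply, eta_adv_refl hp hu hi, Fin.val_rev]

theorem exists_isPD [CharZero K] (hp : p.Nondeg) (hd : p.kind.poch p.d (2 * M) ≠ 0)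
    (D : Fin M → ℕ) (n : ℕ) : ∃ Q, p.IsPD D n Q := by
  obtain ⟨f, hf, hdet⟩ := exists_det_eq hp D n
  obtain ⟨c, hc, hphi⟩ := exists_phi_eq hp (M := M + 1) hd (by omega)
  obtain ⟨S, hS⟩ := exists_coord_add hp M
  obtain ⟨T, hT⟩ := exists_coord_mul hp M
  obtain ⟨Q, hQ⟩ := exists_eval_of_invariant (X := {u // p.IsPoint u})
    (E := fun u => (p.shift M).eta u) (σ := fun u => ⟨p.refl M u, isPoint_refl hp u.2 M⟩)
    (fun u => shift_eta_refl hp u.2) (fun _ => rfl) (fun u => hS u u.2) (fun u => hT u u.2) hf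
  refine ⟨Polynomial.C ((p.constDn D n)⁻¹ * c⁻¹) * Q, fun u hu hne => ?_⟩
  rw [hphi] at hne
  have hV : p.etaVand (M + 1) u ≠ 0 := right_ne_zero_of_mul hne
  have h1 := hdet ⟨u, hu⟩
  have h2 := hdet ⟨p.refl M u, isPoint_refl hp hu M⟩
  simp only at h1 h2
  rw [detMatrix_refl hp hu, Matrix.det_permute, etaVand_refl hp hu, h1, mul_assoc] at h2
  have hs : ((Equiv.Perm.sign (Fin.revPerm (n := M + 1)) : ℤ) : K) ≠ 0 :=
    Int.cast_ne_zero.2 (Units.ne_zero _)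
  -- Invariance of the quotient `f` is obtained only where the Vandermonde product is nonzero, which
  -- is exactly where `IsPD` prescribes a value.
  have h3 := mul_left_cancel₀ hV (mul_left_cancel₀ hs h2)
  have h4 := hQ ⟨u, hu⟩ h3.symm
  simp only at h4
  rw [eval_mul, eval_C, h4]
  change _ = (p.constDn D n)⁻¹ * (p.phi (M + 1) u)⁻¹ * (p.detMatrix D n u).det
  rw [h1, hphi]
  field_simp

/-! ### The coefficients R as entries of a matrix product, and their polynomiality. -/

/-- The values `η(x + i)`, `0 ≤ i < t`, in reverse order. -/
def etaList (p : Params K) (t : ℕ) (u : K) : List K :=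
  (List.range t).reverse.map fun i => p.eta (p.adv i u)

theorem etaList_succ (t : ℕ) : p.etaList (t + 1) u = p.eta (p.adv t u) :: p.etaList t u := by
  simp [etaList, List.range_succ]

theorem length_etaList (t : ℕ) : (p.etaList t u).length = t := by simp [etaList]

/-- The cut-offs in the recursion for R agree with the automatic zeros of the product: entries
outside its band, and entries in negative columns. -/
theorem cR_eq_bandCoeff : ∀ (t : ℕ) (n k : ℤ),
    p.cR t n k u = bandCoeff p.A p.B p.C (p.etaList t u) n (n + k)
  | 0, n, k => by simp [cR, etaList, bandCoeff]
  | t + 1, n, k => by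
    rw [cR]
    split_ifs with h
    · rcases h with h | h
      · rw [bandCoeff_of_length_lt]
        rw [length_etaList]
        push_cast
        rwa [add_sub_cancel_left]
      · rw [bandCoeff_of_right_neg _ _ _ h]
    · rw [etaList_succ, bandCoeff, cR_eq_bandCoeff t, cR_eq_bandCoeff t, cR_eq_bandCoeff t,
        show n + 1 + (k - 1) = n + k by ring, show n - 1 + (k + 1) = n + k by ring]

theorem etaList_refl_perm (hp : p.Nondeg) (hu : p.IsPoint u) :
    (p.etaList (M + 1) (p.refl M u)).Perm (p.etaList (M + 1) u) := by
  have h1 : (List.range (M + 1)).reverse = (List.range (M + 1)).map (M - ·) := by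
    conv_lhs => rw [List.range_eq_range', List.reverse_range']
    exact List.map_congr_left fun i _ => by simp
  have h2 : p.etaList (M + 1) u
      = (List.range (M + 1)).map fun i => p.eta (p.adv i (p.refl M u)) := by
    rw [etaList, h1, List.map_map]
    refine List.map_congr_left fun i hi => ?_
    rw [eta_adv_refl hp hu (Nat.lt_succ_iff.1 (List.mem_range.1 hi))]
    rfl
  rw [h2, etaList, List.map_reverse]
  exact List.reverse_perm _

theorem cR_mem_coordAlg (hp : p.Nondeg) : ∀ (t : ℕ) (n k : ℤ),
    (fun u : {u // p.IsPoint u} => p.cR t n k u) ∈ p.coordAlg M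
  | 0, n, k => const_mem_coordAlg _
  | t + 1, n, k => by
    simp only [cR]
    split_ifs with h
    · exact const_mem_coordAlg _
    · exact Subalgebra.add_mem _ (Subalgebra.add_mem _
        (Subalgebra.mul_mem _ (const_mem_coordAlg _) (cR_mem_coordAlg hp t _ _))
        (Subalgebra.mul_mem _ (Subalgebra.sub_mem _ (const_mem_coordAlg _)
          (eta_adv_mem_coordAlg hp t)) (cR_mem_coordAlg hp t _ _)))
        (Subalgebra.mul_mem _ (const_mem_coordAlg _) (cR_mem_coordAlg hp t _ _))

theorem exists_isR [CharZero K] (hp : p.Nondeg) (M : ℕ) (n k : ℤ) : ∃ Q, p.IsR M n k Q := by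
  obtain ⟨S, hS⟩ := exists_coord_add hp M
  obtain ⟨T, hT⟩ := exists_coord_mul hp M
  obtain ⟨Q, hQ⟩ := exists_eval_of_invariant (X := {u // p.IsPoint u})
    (E := fun u => (p.shift M).eta u) (σ := fun u => ⟨p.refl M u, isPoint_refl hp u.2 M⟩)
    (fun u => shift_eta_refl hp u.2) (fun _ => rfl) (fun u => hS u u.2) (fun u => hT u u.2)
    (cR_mem_coordAlg hp (M + 1) n k)
  refine ⟨Q, fun u hu => hQ ⟨u, hu⟩ ?_⟩
  simp only [cR_eq_bandCoeff]
  exact bandCoeff_perm (etaList_refl_perm hp hu) _ _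

/-! ### Uniqueness: finite fibres of η and finitely many zeros of φ. -/

theorem finite_eta_eq (c : K) : {u | p.IsPoint u ∧ p.eta u = c}.Finite := by
  obtain ⟨_ | q, a, b, e, d⟩ := p
  · have h0 : (X ^ 2 + Polynomial.C d * X - Polynomial.C c : K[X]) ≠ 0 := fun h => by
      have := congrArg (fun P => P.coeff 2) h
      simp at this
    refine (Polynomial.finite_setOfPred_isRoot h0).subset fun u hu => ?_
    have := hu.2
    simp only [eta] at this
    simp only [Set.mem_ofPred_eq, IsRoot.def, eval_add, eval_sub, eval_mul, eval_pow, eval_X, eval_C]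
    linear_combination this
  · have h0 : ((1 - X) * (1 - Polynomial.C d * X) - Polynomial.C c * X : K[X]) ≠ 0 := fun h => by
      have := congrArg (Polynomial.eval 0) h
      simp at this
    refine (Polynomial.finite_setOfPred_isRoot h0).subset fun u hu => ?_
    have h1 : u ≠ 0 := hu.1
    have := hu.2
    simp only [eta] at this
    simp only [Set.mem_ofPred_eq, IsRoot.def, eval_sub, eval_mul, eval_X, eval_C, eval_one]
    rw [← this]
    field_simp
    ring

theorem finite_eta_adv_eq [CharZero K] (hp : p.Nondeg) (j : ℕ) {m : ℕ} (hm : 1 ≤ m) :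
    {u | p.IsPoint u ∧ p.eta (p.adv (j + m) u) - p.eta (p.adv j u) = 0}.Finite := by
  obtain ⟨_ | q, a, b, e, d⟩ := p
  · refine (Set.finite_singleton (-(d + ((2 * j + m : ℕ) : K)) / 2)).subset fun u hu => ?_
    have := hu.2
    rw [eta_adv_add_sub hp hu.1] at this
    have hm' : (m : K) ≠ 0 := Nat.cast_ne_zero.2 (by omega)
    have h2 := (mul_eq_zero.1 this).resolve_left hm'
    simp only at h2
    rw [Set.mem_singleton_iff, eq_div_iff two_ne_zero]
    linear_combination h2
  · have h0 : (1 - Polynomial.C (d * q ^ (2 * j + m)) * X ^ 2 : K[X]) ≠ 0 := fun h => by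
      have := congrArg (Polynomial.eval 0) h
      simp at this
    refine (Polynomial.finite_setOfPred_isRoot h0).subset fun u hu => ?_
    have := hu.2
    rw [eta_adv_add_sub hp hu.1] at this
    obtain ⟨hq, hq1, -⟩ := hp
    have hu1 : u ≠ 0 := hu.1
    have h2 := (mul_eq_zero.1 this).resolve_left
      (inv_ne_zero (mul_ne_zero hu1 (pow_ne_zero _ hq)))
    have h3 := (mul_eq_zero.1 h2).resolve_left (sub_ne_zero.2 (hq1 m hm).symm)
    simpa using h3

theorem infinite_isPoint [CharZero K] : {u | p.IsPoint u}.Infinite := by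
  obtain ⟨_ | q, a, b, e, d⟩ := p
  · exact Set.infinite_univ
  · exact (Set.finite_singleton (0 : K)).infinite_compl

/-- A polynomial is determined by its values at the `η(x; lam + M δ)` with `φ_{M+1}(x) ≠ 0`. -/
theorem eq_of_eval_eta_eq [CharZero K] (hp : p.Nondeg) (hd : p.kind.poch p.d (2 * M) ≠ 0)
    {P Q : K[X]} (h : ∀ u, p.IsPoint u → p.phi (M + 1) u ≠ 0 →
      P.eval ((p.shift M).eta u) = Q.eval ((p.shift M).eta u)) : P = Q := by
  by_contra hPQ
  have hPQ' : P - Q ≠ 0 := sub_ne_zero.2 hPQ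
  obtain ⟨c, hc, hphi⟩ := exists_phi_eq hp (M := M + 1) hd (by omega)
  -- If P ≠ Q, every point lies over one of the finitely many roots of P - Q or is a zero of a
  -- factor of φ. That would leave only finitely many points.
  refine infinite_isPoint (p := p) (Set.Finite.subset (s :=
    (⋃ c ∈ {c | (P - Q).IsRoot c}, {u | (p.shift M).IsPoint u ∧ (p.shift M).eta u = c})
    ∪ ⋃ i : Fin (M + 1), ⋃ j ∈ {j : Fin (M + 1) | i < j},
      {u | p.IsPoint u ∧ p.eta (p.adv ((i : ℕ) + (j - i : ℕ)) u) - p.eta (p.adv (i : ℕ) u) = 0})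
    ?_ fun u hu => ?_)
  · refine Set.Finite.union ((Polynomial.finite_setOfPred_isRoot hPQ').biUnion
      fun c _ => finite_eta_eq c) (Set.finite_iUnion fun i => (Set.toFinite _).biUnion
      fun j hj => finite_eta_adv_eq hp i ?_)
    have : (i : ℕ) < j := hj
    omega
  · by_cases hV : p.phi (M + 1) u = 0
    · rw [hphi, mul_eq_zero, or_iff_right hc, etaVand, Finset.prod_eq_zero_iff] at hV
      obtain ⟨i, -, hi⟩ := hV
      obtain ⟨j, hj, hij⟩ := Finset.prod_eq_zero_iff.1 hi
      rw [Finset.mem_Ioi] at hj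
      refine Or.inr (Set.mem_iUnion.2 ⟨i, Set.mem_iUnion₂.2 ⟨j, hj, hu, ?_⟩⟩)
      rwa [Nat.add_sub_cancel' (le_of_lt hj)]
    · refine Or.inl (Set.mem_iUnion₂.2 ⟨(p.shift M).eta u, ?_, ?_, rfl⟩)
      · simp [IsRoot.def, h u hu hV]
      · obtain ⟨_ | q, a, b, e, d⟩ := p <;> exact hu

theorem isPD_iff [CharZero K] (hp : p.Nondeg) (hd : p.kind.poch p.d (2 * M) ≠ 0) (D : Fin M → ℕ)
    (m : ℕ) (Q : K[X]) : p.IsPD D m Q ↔ Q = p.PD D m := by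
  have h : p.IsPD D m (p.PD D m) := by
    rw [PD, if_neg (by omega)]
    exact Classical.epsilon_spec (exists_isPD hp hd D m)
  refine ⟨fun hQ => eq_of_eval_eta_eq hp hd fun u hu hu' => ?_, fun hQ => hQ ▸ h⟩
  rw [hQ u hu hu', h u hu hu']

theorem isR_iff [CharZero K] (hp : p.Nondeg) (hd : p.kind.poch p.d (2 * M) ≠ 0)
    (n k : ℤ) (Q : K[X]) : p.IsR M n k Q ↔ Q = p.R M n k := by
  have h : p.IsR M n k (p.R M n k) := Classical.epsilon_spec (exists_isR hp M n k)
  refine ⟨fun hQ => eq_of_eval_eta_eq hp hd fun u hu _ => ?_, fun hQ => hQ ▸ h⟩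
  rw [hQ u hu, h u hu]

end Params

end MultiRacah

/-! ### Degrees of the coefficients R from their behaviour at infinity. -/

namespace MultiRacah

namespace Params

variable {K : Type*} [Field K] {p : Params K}

/-- The point `x = 1 / v`, resp. `q ^ x = v`, which tends to infinity as `v → 0`. -/
def ray (p : Params K) (v : K) : K :=
  match p.kind with
  | .racah => v⁻¹
  | .qRacah _ => v

/-- The order of the pole of `η` at `v = 0`. -/
def poleOrder (p : Params K) : ℕ :=
  match p.kind with
  | .racah => 2
  | .qRacah _ => 1

/-- `f` is `η ^ m` times a function with the value `c` at infinity. -/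
def HasSymbol (p : Params K) (f : K → K) (m : ℕ) (c : K) : Prop :=
  ∃ F : K[X], F.eval 0 = c ∧ ∀ v ≠ 0, v ^ (p.poleOrder * m) * f (p.ray v) = F.eval v

/-- The symbol of `η(x + i)`. -/
def etaSymbol (p : Params K) (i : ℕ) : K :=
  match p.kind with
  | .racah => 1
  | .qRacah q => q⁻¹ ^ i

theorem poleOrder_pos {K : Type*} {p : Params K} : 0 < p.poleOrder := by
  obtain ⟨_ | q, a, b, c, d⟩ := p <;> simp [poleOrder]

namespace HasSymbol

variable {f g : K → K} {m n : ℕ} {c e : K}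

theorem const (c : K) : p.HasSymbol (fun _ => c) 0 c :=
  ⟨Polynomial.C c, by simp, fun v _ => by simp⟩

theorem zero (m : ℕ) : p.HasSymbol (fun _ => 0) m 0 := ⟨0, by simp, fun v _ => by simp⟩

theorem add (hf : p.HasSymbol f m c) (hg : p.HasSymbol g m e) :
    p.HasSymbol (fun u => f u + g u) m (c + e) := by
  obtain ⟨F, hF, hF'⟩ := hf
  obtain ⟨G, hG, hG'⟩ := hg
  exact ⟨F + G, by simp [hF, hG], fun v hv => by rw [mul_add, hF' v hv, hG' v hv, eval_add]⟩

theorem mul (hf : p.HasSymbol f m c) (hg : p.HasSymbol g n e) :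
    p.HasSymbol (fun u => f u * g u) (m + n) (c * e) := by
  obtain ⟨F, hF, hF'⟩ := hf
  obtain ⟨G, hG, hG'⟩ := hg
  refine ⟨F * G, by simp [hF, hG], fun v hv => ?_⟩
  rw [mul_add, pow_add, mul_mul_mul_comm, hF' v hv, hG' v hv, eval_mul]

theorem const_mul (x : K) (hf : p.HasSymbol f m c) : p.HasSymbol (fun u => x * f u) m (x * c) := by
  simpa using (const x).mul hf

theorem of_lt (hf : p.HasSymbol f m c) (h : m < n) : p.HasSymbol f n 0 := by
  obtain ⟨F, hF, hF'⟩ := hf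
  obtain ⟨k, rfl⟩ := Nat.exists_eq_add_of_lt h
  have hk : p.poleOrder * (k + 1) ≠ 0 := Nat.mul_ne_zero poleOrder_pos.ne' (Nat.succ_ne_zero k)
  refine ⟨F * X ^ (p.poleOrder * (k + 1)), by simp [hk], fun v hv => ?_⟩
  rw [eval_mul, ← hF' v hv, eval_pow, eval_X, add_assoc, mul_add, pow_add]
  ring

theorem unique [CharZero K] (hf : p.HasSymbol f m c) (hf' : p.HasSymbol f m e) : c = e := by
  obtain ⟨F, rfl, hF'⟩ := hf
  obtain ⟨G, rfl, hG'⟩ := hf'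
  have : F = G := by
    refine Polynomial.eq_of_infinite_eval_eq F G
      ((Set.finite_singleton (0 : K)).infinite_compl.mono fun v hv => ?_)
    exact (hF' v hv).symm.trans (hG' v hv)
  rw [this]

theorem pow (hf : p.HasSymbol f 1 1) : ∀ j : ℕ, p.HasSymbol (fun u => f u ^ j) j 1
  | 0 => by simpa using const (1 : K)
  | j + 1 => by simpa [pow_succ] using (pow hf j).mul hf

theorem eval (hf : p.HasSymbol f 1 1) (Q : K[X]) {N : ℕ} (hN : Q.natDegree ≤ N) :
    p.HasSymbol (fun u => Q.eval (f u)) N (Q.coeff N) := by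
  have key : ∀ n ≤ N, p.HasSymbol
      (fun u => ∑ j ∈ Finset.range n, Q.coeff j * f u ^ j) N 0 := by
    intro n hn
    induction n with
    | zero => simpa using zero N
    | succ n ih =>
      simp only [Finset.sum_range_succ]
      simpa using (ih (by omega)).add (((hf.pow n).of_lt (n := N) (by omega)).const_mul (Q.coeff n))
  have h := (key N le_rfl).add ((hf.pow N).const_mul (Q.coeff N))
  simp only [Polynomial.eval_eq_sum_range' (Nat.lt_succ_of_le hN), Finset.sum_range_succ]
  simpa using h

/-- At its true degree Q(f) has the leading coefficient of Q as symbol. A degree above m would force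
that coefficient to be 0, by uniqueness of symbols. -/
theorem natDegree_le [CharZero K] (hf : p.HasSymbol f 1 1) {Q : K[X]}
    (h : p.HasSymbol (fun u => Q.eval (f u)) m c) : Q.natDegree ≤ m ∧ Q.coeff m = c := by
  have h1 : Q.natDegree ≤ m := by
    by_contra hlt
    have h0 : Q.leadingCoeff = 0 := (hf.eval Q le_rfl).unique (h.of_lt (by omega))
    rw [leadingCoeff_eq_zero] at h0
    simp [h0] at hlt
  exact ⟨h1, (hf.eval Q h1).unique h⟩

end HasSymbol

theorem hasSymbol_eta_adv (hp : p.Nondeg) (i : ℕ) :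
    p.HasSymbol (fun u => p.eta (p.adv i u)) 1 (p.etaSymbol i) := by
  obtain ⟨_ | q, a, b, c, d⟩ := p
  · refine ⟨(1 + Polynomial.C (i : K) * X) * (1 + Polynomial.C (i + d) * X), by simp [etaSymbol],
      fun v hv => ?_⟩
    simp only [poleOrder, ray, eta, adv, eval_mul, eval_add, eval_one, eval_X, eval_C]
    field_simp
    ring
  · have hq : q ≠ 0 := hp.1
    refine ⟨(Polynomial.C (q⁻¹ ^ i) - X) * (1 - Polynomial.C (d * q ^ i) * X), by simp [etaSymbol],
      fun v hv => ?_⟩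
    simp only [poleOrder, ray, eta, adv, eval_mul, eval_sub, eval_one, eval_X, eval_C, inv_pow]
    field_simp
    ring

theorem hasSymbol_shift_eta (M : ℕ) : p.HasSymbol (p.shift M).eta 1 1 := by
  obtain ⟨_ | q, a, b, c, d⟩ := p
  · refine ⟨1 + Polynomial.C (d + M) * X, by simp, fun v hv => ?_⟩
    simp only [poleOrder, ray, eta, shift, eval_mul, eval_add, eval_one, eval_X, eval_C]
    field_simp
  · refine ⟨(1 - X) * (1 - Polynomial.C (d * q ^ M) * X), by simp, fun v hv => ?_⟩
    simp only [poleOrder, ray, eta, shift, eval_mul, eval_sub, eval_one, eval_X, eval_C]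
    field_simp
    ring

/-- The coefficients of `∏_{i < t} (X - κ_i)`, where `κ_i` is the symbol of `η(x + i)`. -/
noncomputable def symbolCoeff (p : Params K) (t k : ℕ) : K :=
  (∏ i ∈ Finset.range t, (X - Polynomial.C (p.etaSymbol i))).coeff k

theorem symbolCoeff_succ_zero (t : ℕ) :
    p.symbolCoeff (t + 1) 0 = -p.etaSymbol t * p.symbolCoeff t 0 := by
  simp [symbolCoeff, Finset.prod_range_succ, mul_coeff_zero]
  ring

theorem symbolCoeff_succ_succ (t k : ℕ) : p.symbolCoeff (t + 1) (k + 1)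
    = p.symbolCoeff t k - p.etaSymbol t * p.symbolCoeff t (k + 1) := by
  rw [symbolCoeff, Finset.prod_range_succ, coeff_mul_X_sub_C, mul_comm]
  rfl

theorem symbolCoeff_of_lt {t k : ℕ} (h : t < k) : p.symbolCoeff t k = 0 := by
  refine coeff_eq_zero_of_natDegree_lt (lt_of_le_of_lt ?_ h)
  simp [Polynomial.natDegree_finsetProd_X_sub_C_eq_card]

/-- In the Racah case the product is (X - 1)^t, with binomial coefficients that are nonzero in
characteristic 0. In the q-case it has roots q^{-i}, and the q-binomial lemma applies with base q⁻¹.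
-/
theorem symbolCoeff_ne_zero [CharZero K] (hp : p.Nondeg) {t k : ℕ} (h : k ≤ t) :
    p.symbolCoeff t k ≠ 0 := by
  obtain ⟨_ | q, a, b, c, d⟩ := p
  · simp only [symbolCoeff, etaSymbol, Finset.prod_const, Finset.card_range]
    rw [sub_eq_add_neg, ← map_neg, Polynomial.coeff_X_add_C_pow]
    exact mul_ne_zero (pow_ne_zero _ (neg_ne_zero.2 one_ne_zero))
      (Nat.cast_ne_zero.2 (Nat.choose_pos h).ne')
  · refine coeff_prod_X_sub_pow_ne_zero (inv_ne_zero hp.1) (fun k hk => ?_) t k h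
    rw [inv_pow, ne_eq, inv_eq_one]
    exact hp.2.1 k hk

/-- The entry `(n, m)` of the `|m - n|`-th power of the tridiagonal matrix. -/
noncomputable def pathCoeff (p : Params K) (n m : ℤ) : K :=
  (∏ l ∈ Finset.Ico n m, p.A l) * ∏ l ∈ Finset.Ioc m n, p.C l

theorem pathCoeff_self (n : ℤ) : p.pathCoeff n n = 1 := by simp [pathCoeff]

theorem pathCoeff_of_lt {n m : ℤ} (h : n < m) :
    p.pathCoeff n m = p.A n * p.pathCoeff (n + 1) m := by
  have h1 : Finset.Ico n m = insert n (Finset.Ico (n + 1) m) := by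
    ext l; simp only [Finset.mem_Ico, Finset.mem_insert]; omega
  rw [pathCoeff, pathCoeff, h1, Finset.prod_insert (by simp), Finset.Ioc_eq_empty (by omega),
    Finset.Ioc_eq_empty (by omega), mul_assoc]

theorem pathCoeff_of_gt {n m : ℤ} (h : m < n) :
    p.pathCoeff n m = p.C n * p.pathCoeff (n - 1) m := by
  have h1 : Finset.Ioc m n = insert n (Finset.Ioc m (n - 1)) := by
    ext l; simp only [Finset.mem_Ioc, Finset.mem_insert]; omega
  rw [pathCoeff, pathCoeff, h1, Finset.prod_insert (by simp), Finset.Ico_eq_empty (by omega),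
    Finset.Ico_eq_empty (by omega)]
  ring

/-- The entry is a sum over paths of t steps from n to m, and only the diagonal steps contribute
factors η. The top order comes from paths with exactly |m - n| off-diagonal steps, all in one
direction. Their off-diagonal weights multiply to `pathCoeff`, and summing the factors -κ_i over the
positions of the r diagonal steps gives `symbolCoeff`. -/
theorem hasSymbol_bandCoeff (hp : p.Nondeg) {m : ℤ} (hm : 0 ≤ m) :
    ∀ (t : ℕ) (n : ℤ) (r : ℕ), r + (m - n).natAbs = t →
      p.HasSymbol (fun u => bandCoeff p.A p.B p.C (p.etaList t u) n m) r
        (p.symbolCoeff t (m - n).natAbs * p.pathCoeff n m)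
  | 0, n, r, h => by
    obtain rfl : r = 0 := by omega
    obtain rfl : m = n := by omega
    simpa [etaList, bandCoeff, hm, symbolCoeff, pathCoeff_self] using HasSymbol.const (p := p) 1
  | t + 1, n, r, h => by
    have ih := hasSymbol_bandCoeff hp hm t
    have hvan : ∀ n', t < (m - n').natAbs →
        (fun u => bandCoeff p.A p.B p.C (p.etaList t u) n' m) = fun _ => 0 := fun n' h' => by
      ext u
      refine bandCoeff_of_length_lt _ _ _ ?_
      rw [length_etaList, Int.abs_eq_natAbs]
      exact_mod_cast h'
    -- A first step away from m leaves too few diagonal steps to reach order r.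
    have hlow : ∀ n', t < r + (m - n').natAbs →
        p.HasSymbol (fun u => bandCoeff p.A p.B p.C (p.etaList t u) n' m) r 0 := fun n' h' => by
      rcases Nat.lt_or_ge t (m - n').natAbs with h'' | h''
      · rw [hvan n' h'']
        exact HasSymbol.zero r
      · exact (ih n' (t - (m - n').natAbs) (by omega)).of_lt (by omega)
    have hmid : p.HasSymbol (fun u => (p.B n - p.eta (p.adv t u))
          * bandCoeff p.A p.B p.C (p.etaList t u) n m) r
        (-p.etaSymbol t * (p.symbolCoeff t (m - n).natAbs * p.pathCoeff n m)) := by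
      rcases Nat.eq_zero_or_pos r with rfl | hr
      · have hz := hvan n (by omega)
        rw [symbolCoeff_of_lt (show t < (m - n).natAbs by omega)]
        have : (fun u => (p.B n - p.eta (p.adv t u))
            * bandCoeff p.A p.B p.C (p.etaList t u) n m) = fun _ => 0 := by
          ext u
          rw [congrFun hz u, mul_zero]
        rw [this, zero_mul, mul_zero]
        exact HasSymbol.zero 0
      · obtain ⟨r, rfl⟩ : ∃ r', r = r' + 1 := ⟨r - 1, by omega⟩
        have h1 := ((HasSymbol.const (p := p) (p.B n)).of_lt zero_lt_one).add
          ((hasSymbol_eta_adv hp t).const_mul (-1))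
        have h2 := h1.mul (ih n r (by omega))
        rw [add_comm 1 r] at h2
        convert h2 using 1
        · ext u; ring
        · ring
    simp only [etaList_succ, bandCoeff]
    rcases lt_trichotomy n m with hnm | rfl | hnm
    · obtain ⟨k, hk⟩ : ∃ k, (m - n).natAbs = k + 1 := ⟨(m - n).natAbs - 1, by omega⟩
      have hk' : (m - (n + 1)).natAbs = k := by omega
      have h1 := (ih (n + 1) r (by omega)).const_mul (p.A n)
      have h3 := (hlow (n - 1) (by omega)).const_mul (p.C n)
      convert (h1.add hmid).add h3 using 1
      rw [hk, hk', symbolCoeff_succ_succ, pathCoeff_of_lt hnm]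
      ring
    · have h1 := (hlow (n + 1) (by omega)).const_mul (p.A n)
      have h3 := (hlow (n - 1) (by omega)).const_mul (p.C n)
      convert (h1.add hmid).add h3 using 1
      rw [sub_self, Int.natAbs_zero, symbolCoeff_succ_zero]
      ring
    · obtain ⟨k, hk⟩ : ∃ k, (m - n).natAbs = k + 1 := ⟨(m - n).natAbs - 1, by omega⟩
      have hk' : (m - (n - 1)).natAbs = k := by omega
      have h1 := (hlow (n + 1) (by omega)).const_mul (p.A n)
      have h3 := (ih (n - 1) r (by omega)).const_mul (p.C n)
      convert (h1.add hmid).add h3 using 1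
      rw [hk, hk', symbolCoeff_succ_succ, pathCoeff_of_gt hnm]
      ring

theorem isPoint_ray {v : K} (hv : v ≠ 0) : p.IsPoint (p.ray v) := by
  obtain ⟨_ | q, a, b, c, d⟩ := p
  · trivial
  · exact hv

theorem HasSymbol.congr {f g : K → K} {m : ℕ} {c : K} (hf : p.HasSymbol f m c)
    (h : ∀ u, p.IsPoint u → g u = f u) : p.HasSymbol g m c := by
  obtain ⟨F, hF, hF'⟩ := hf
  exact ⟨F, hF, fun v hv => by rw [h _ (isPoint_ray hv), hF' v hv]⟩

theorem cR_of_neg {n k : ℤ} (h : n < 0 ∨ n + k < 0) (t : ℕ) (u : K) : p.cR t n k u = 0 := by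
  rw [cR_eq_bandCoeff]
  rcases h with h | h
  · exact bandCoeff_of_left_neg p.A_neg_one _ _ _ h
  · exact bandCoeff_of_right_neg _ _ _ h

theorem natDegree_le_of_isR [CharZero K] (hp : p.Nondeg) {M : ℕ} {n k : ℤ} (hk : |k| ≤ M + 1)
    {Q : K[X]} (hQ : p.IsR M n k Q) (hm : 0 ≤ n + k) : Q.natDegree ≤ M + 1 - k.natAbs
      ∧ Q.coeff (M + 1 - k.natAbs) = p.symbolCoeff (M + 1) k.natAbs * p.pathCoeff n (n + k) := by
  rw [Int.abs_eq_natAbs] at hk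
  have h := hasSymbol_bandCoeff hp hm (M + 1) n (M + 1 - k.natAbs)
    (by rw [add_sub_cancel_left]; omega)
  rw [add_sub_cancel_left] at h
  exact (hasSymbol_shift_eta M).natDegree_le
    (h.congr fun u hu => by rw [hQ u hu, cR_eq_bandCoeff])

end Params

end MultiRacah

/-! ### Normalization constants and the recurrence relation. -/

namespace MultiRacah

namespace Params

variable {K : Type*} [Field K] {p : Params K} {M : ℕ}

theorem A_ne_zero {m : ℕ} (ha : p.kind.poch p.a (m + 1) ≠ 0) (hb : p.kind.poch p.b (m + 1) ≠ 0)
    (hc : p.kind.poch p.c (m + 1) ≠ 0) (hd : p.kind.poch p.dt (2 * m + 2) ≠ 0) :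
    p.A m ≠ 0 := by
  have hm : (m : ℤ) ≠ -1 := by omega
  rw [A, if_neg hm]
  obtain ⟨_ | q, a, b, c, d⟩ := p
  · have h1 := Kind.add_ne_zero_of_poch ha (Nat.lt_succ_self m)
    have h2 := Kind.add_ne_zero_of_poch hb (Nat.lt_succ_self m)
    have h3 := Kind.add_ne_zero_of_poch hc (Nat.lt_succ_self m)
    have h4 := Kind.add_ne_zero_of_poch hd (show m < 2 * m + 2 by omega)
    have h5 := Kind.add_ne_zero_of_poch hd (show 2 * m < 2 * m + 2 by omega)
    have h6 := Kind.add_ne_zero_of_poch hd (show 2 * m + 1 < 2 * m + 2 by omega)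
    rw [add_comm] at h1 h2 h3 h4 h5 h6
    push_cast at h5 h6 ⊢
    exact div_ne_zero (mul_ne_zero (mul_ne_zero (mul_ne_zero h1 h2) h3) h4) (mul_ne_zero h5 h6)
  · have h1 := Kind.one_sub_ne_zero_of_poch ha (Nat.lt_succ_self m)
    have h2 := Kind.one_sub_ne_zero_of_poch hb (Nat.lt_succ_self m)
    have h3 := Kind.one_sub_ne_zero_of_poch hc (Nat.lt_succ_self m)
    have h4 := Kind.one_sub_ne_zero_of_poch hd (show m < 2 * m + 2 by omega)
    have h5 := Kind.one_sub_ne_zero_of_poch hd (show 2 * m < 2 * m + 2 by omega)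
    have h6 := Kind.one_sub_ne_zero_of_poch hd (show 2 * m + 1 < 2 * m + 2 by omega)
    rw [← zpow_natCast] at h1 h2 h3 h4 h5 h6
    push_cast at h5 h6
    exact div_ne_zero (mul_ne_zero (mul_ne_zero (mul_ne_zero h1 h2) h3) h4) (mul_ne_zero h5 h6)

theorem phi_origin_ne_zero [CharZero K] (hp : p.Nondeg) {N : ℕ} (hd : p.kind.poch p.d N ≠ 0)
    (hM : 2 * M ≤ N + 2) : p.phi M p.origin ≠ 0 := by
  refine Finset.prod_ne_zero_iff.2 fun k hk => Finset.prod_ne_zero_iff.2 fun j hj => ?_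
  rw [Finset.mem_range] at hk hj
  obtain ⟨m, rfl⟩ := Nat.exists_eq_add_of_le hj.le
  rw [Nat.add_sub_cancel_left]
  refine div_ne_zero (eta_adv_sub_origin_ne_zero hp hd (by omega) (by omega)) ?_
  have := eta_adv_sub_origin_ne_zero hp hd (j := 0) (m := m) (by omega) (by omega)
  rwa [adv_zero, eta_origin, sub_zero, zero_add] at this

theorem alpha_ne_zero (hp : p.Nondeg) : p.alpha ≠ 0 := by
  obtain ⟨_ | q, a, b, c, d⟩ := p
  · exact one_ne_zero
  · obtain ⟨h1, -, h3, h4, -, h6⟩ := hp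
    exact mul_ne_zero (mul_ne_zero (mul_ne_zero h3 h4) (inv_ne_zero h6)) (inv_ne_zero h1)

theorem potB_adv_origin_ne_zero {j m N : ℕ} (ha : p.kind.poch p.a m ≠ 0)
    (hb : p.kind.poch p.b m ≠ 0) (hc : p.kind.poch p.c m ≠ 0) (hd : p.kind.poch p.d N ≠ 0)
    (hm : j < m) (hN : 2 * j + 1 < N) : p.potB (p.adv j p.origin) ≠ 0 := by
  obtain ⟨_ | q, a, b, c, d⟩ := p
  · have h1 := Kind.add_ne_zero_of_poch ha hm
    have h2 := Kind.add_ne_zero_of_poch hb hm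
    have h3 := Kind.add_ne_zero_of_poch hc hm
    have h4 := Kind.add_ne_zero_of_poch hd (show j < N by omega)
    have h5 := Kind.add_ne_zero_of_poch hd (show 2 * j < N by omega)
    have h6 := Kind.add_ne_zero_of_poch hd hN
    rw [add_comm] at h1 h2 h3 h4 h5 h6
    push_cast at h5 h6
    simp only [potB, adv, origin, zero_add]
    exact div_ne_zero (neg_ne_zero.2 (mul_ne_zero (mul_ne_zero (mul_ne_zero h1 h2) h3) h4))
      (mul_ne_zero h5 h6)
  · have h1 := Kind.one_sub_ne_zero_of_poch ha hm
    have h2 := Kind.one_sub_ne_zero_of_poch hb hm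
    have h3 := Kind.one_sub_ne_zero_of_poch hc hm
    have h4 := Kind.one_sub_ne_zero_of_poch hd (show j < N by omega)
    have h5 := Kind.one_sub_ne_zero_of_poch hd (show j * 2 < N by omega)
    have h6 := Kind.one_sub_ne_zero_of_poch hd (show 1 + j * 2 < N by omega)
    rw [pow_mul] at h5
    rw [pow_add, pow_one, pow_mul, ← mul_assoc] at h6
    simp only [potB, adv, origin, one_mul]
    exact div_ne_zero (neg_ne_zero.2 (mul_ne_zero (mul_ne_zero (mul_ne_zero h1 h2) h3) h4))
      (mul_ne_zero h5 h6)

theorem potB'_adv_origin_ne_zero {j m N : ℕ} (ha : p.kind.poch p.twist.a m ≠ 0)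
    (hb : p.kind.poch p.twist.b m ≠ 0) (hc : p.kind.poch p.twist.c m ≠ 0)
    (hd : p.kind.poch p.d N ≠ 0) (hm : j < m) (hN : 2 * j + 1 < N) :
    p.potB' (p.adv j p.origin) ≠ 0 := by
  have := potB_adv_origin_ne_zero (p := p.twist) (j := j) (m := m) (N := N)
  obtain ⟨_ | q, a, b, c, d⟩ := p
  · exact this ha hb hc hd hm hN
  · exact this ha hb hc hd hm hN

/-- Since the zero-based index i is smaller than its d, the nonvanishing Pochhammer symbols of
length d include the factors occurring in B'(i). -/
theorem lt_of_strictMono {D : Fin M → ℕ} (hD : StrictMono D) (hD1 : ∀ j, 1 ≤ D j) :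
    ∀ (i : ℕ) (hi : i < M), i < D ⟨i, hi⟩
  | 0, hi => hD1 _
  | i + 1, hi => by
    have h1 := lt_of_strictMono hD hD1 i (by omega)
    have h2 := hD (show (⟨i, by omega⟩ : Fin M) < ⟨i + 1, hi⟩ by simp)
    omega

/-- Isolates the dependence of C_{D,m} on m. The common nonzero factor κ is what makes the two forms
of the recurrence equivalent. -/
theorem exists_constDn_eq [CharZero K] {D : Fin M → ℕ} (hD : StrictMono D) (hD1 : ∀ j, 1 ≤ D j)
    {n : ℤ} (h : p.DenomsNeZero D n) : ∃ κ : K, κ ≠ 0 ∧ ∀ m,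
      p.constDn D m = κ * ∏ j, (p.energy m - p.venergy (D j)) := by
  have hp : p.Nondeg := h.base
  have hden : ∀ j : Fin M, p.alpha * p.potB' (p.adv (j : ℕ) p.origin) ≠ 0 := fun j =>
    mul_ne_zero (alpha_ne_zero hp) (potB'_adv_origin_ne_zero (h.virtual j).1 (h.virtual j).2.1
      (h.virtual j).2.2 h.point (lt_of_strictMono hD hD1 j j.2) (by omega))
  have h1 := phi_origin_ne_zero hp (M := M) h.point (by omega)
  have h2 := phi_origin_ne_zero hp (M := M + 1) h.point (by omega)
  have h3 : p.constD D ≠ 0 := mul_ne_zero (inv_ne_zero h1) (Finset.prod_ne_zero_iff.2 fun k _ =>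
    Finset.prod_ne_zero_iff.2 fun j hj => div_ne_zero
      (sub_ne_zero.2 (h.venergy_inj j k (Finset.mem_Iio.1 hj).ne)) (hden j))
  refine ⟨(-1) ^ M * p.constD D * (p.phi M p.origin / p.phi (M + 1) p.origin
    / ∏ j : Fin M, p.alpha * p.potB' (p.adv (j : ℕ) p.origin)), ?_, fun m => ?_⟩
  · exact mul_ne_zero (mul_ne_zero (pow_ne_zero _ (neg_ne_zero.2 one_ne_zero)) h3)
      (div_ne_zero (div_ne_zero h1 h2) (Finset.prod_ne_zero_iff.2 fun j _ => hden j))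
  · rw [constDn, dtSq, Finset.prod_div_distrib]
    ring

/-- The determinant expanded along its last column. -/
theorem det_detMatrix (D : Fin M → ℕ) (u : K) : ∃ w : Fin (M + 1) → K, ∀ n : ℕ,
    (p.detMatrix D n u).det = ∑ i, w i * p.cP n (p.adv (i : ℕ) u) := by
  -- The cofactors involve only the virtual state columns, so the weights do not depend on `n`.
  refine ⟨fun i => (-1) ^ ((i : ℕ) + M) * p.r M i u
    * (Matrix.of fun (i' : Fin M) (k : Fin M) =>
      p.cXi (D k) (p.adv (i.succAbove i' : ℕ) u)).det, fun n => ?_⟩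
  rw [Matrix.det_succ_column _ (Fin.last M)]
  refine Finset.sum_congr rfl fun i _ => ?_
  have : (p.detMatrix D n u).submatrix i.succAbove (Fin.last M).succAbove
      = Matrix.of fun (i' : Fin M) (k : Fin M) =>
        p.cXi (D k) (p.adv (i.succAbove i' : ℕ) u) := by
    ext i' k
    simp [detMatrix, Fin.succAbove_last]
  rw [this]
  simp only [detMatrix, Matrix.of_apply, Fin.snoc_last, Fin.val_last]
  ring

/-- The values P_m(x+i) form an eigenvector of J with eigenvalue η(x+i), and J - η(x+i) is one of
the M+1 factors of the product whose row n is R. -/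
theorem sum_cR_mul_cP [CharZero K] {D : Fin M → ℕ} {n : ℤ} (h : p.DenomsNeZero D n)
    (hn : 0 ≤ n) {u : K} (hu : p.IsPoint u) {i : ℕ} (hi : i ≤ M) :
    ∑ k ∈ Finset.Icc (-(M : ℤ) - 1) ((M : ℤ) + 1), p.cR (M + 1) n k u
      * (if n + k < 0 then 0 else p.cP (n + k).toNat (p.adv i u)) = 0 := by
  have hp : p.Nondeg := h.base
  set Ψ : ℤ → K := fun m => if m < 0 then 0 else p.cP m.toNat (p.adv i u) with hΨ
  have h3 : ∀ m : ℤ, 0 ≤ m → m < n + M + 1 → p.eta (p.adv i u) * Ψ m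
      = p.A m * Ψ (m + 1) + p.B m * Ψ m + p.C m * Ψ (m - 1) := by
    intro m hm hm'
    lift m to ℕ using hm
    obtain ⟨ha, hb, hc⟩ := h.racah (m + 1) (by push_cast; omega)
    have := eta_mul_cP hp ha hb hc (h.recur m (by omega)) (isPoint_adv hp hu i)
    have e1 : Ψ m = p.cP m (p.adv i u) := by simp [hΨ]
    have e2 : Ψ (m + 1) = p.cP (m + 1) (p.adv i u) := by
      have : ¬ ((m : ℤ) + 1 < 0) := by omega
      simp only [hΨ, this, if_false]
      rfl
    have e3 : p.C m * Ψ (m - 1) = p.C m * p.cP (m - 1) (p.adv i u) := by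
      rcases m with _ | m
      · simp [C_zero]
      · have : ¬ (((m + 1 : ℕ) : ℤ) - 1 < 0) := by omega
        simp only [hΨ, this, if_false]
        congr 2
        omega
    rw [e1, e2, e3, this]
  have h4 := sum_bandCoeff_mul p.A_neg_one p.C_zero h3 (p.etaList (M + 1) u) n hn
    (by rw [length_etaList]; push_cast; omega)
  have h5 : ((p.etaList (M + 1) u).map (p.eta (p.adv i u) - ·)).prod = 0 := by
    rw [List.prod_eq_zero_iff, etaList, List.map_map, List.mem_map]
    exact ⟨i, by simp; omega, by simp⟩
  rw [h5, zero_mul] at h4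
  refine Eq.trans ?_ h4
  have h6 : Finset.Icc (n + (-(M : ℤ) - 1)) (n + ((M : ℤ) + 1))
      = (Finset.Icc (-(M : ℤ) - 1) ((M : ℤ) + 1)).map (addLeftEmbedding n) :=
    (Finset.map_add_left_Icc _ _ _).symm
  have h7 : ∑ k ∈ Finset.Icc (-(M : ℤ) - 1) ((M : ℤ) + 1), p.cR (M + 1) n k u * Ψ (n + k)
      = ∑ m ∈ Finset.Icc (n + (-(M : ℤ) - 1)) (n + ((M : ℤ) + 1)),
        bandCoeff p.A p.B p.C (p.etaList (M + 1) u) n m * Ψ m := by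
    rw [h6, Finset.sum_map]
    exact Finset.sum_congr rfl fun k _ => by rw [cR_eq_bandCoeff]; rfl
  -- The windows |m - n| ≤ M+1 and 0 ≤ m ≤ n+M+1 differ only in negative m, where Ψ is 0, and in
  -- indices outside the band.
  refine h7.trans (Finset.sum_congr_of_eq_on_inter (fun m hm hm' => ?_) (fun m hm hm' => ?_)
    fun _ _ _ => rfl)
  · rw [Finset.mem_Icc] at hm hm'
    have : m < 0 := by omega
    simp [hΨ, this]
  · rw [Finset.mem_Icc] at hm hm'
    have hlt : ((p.etaList (M + 1) u).length : ℤ) < |m - n| := by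
      rw [length_etaList, lt_abs]
      omega
    rw [bandCoeff_of_length_lt _ _ _ hlt, zero_mul]

theorem R_eq_zero [CharZero K] {D : Fin M → ℕ} {n : ℤ} (h : p.DenomsNeZero D n) {k : ℤ}
    (hk : n < 0 ∨ n + k < 0) : p.R M n k = 0 :=
  ((isR_iff h.base h.point n k 0).1 fun u _ => by rw [eval_zero, cR_of_neg hk]).symm

/-- The recurrence relations with variable dependent coefficients. -/
theorem sum_constDn_mul_R_mul_PD [CharZero K] {D : Fin M → ℕ} (hD : StrictMono D)
    (hD1 : ∀ j, 1 ≤ D j) {n : ℤ} (h : p.DenomsNeZero D n) :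
    ∑ k ∈ Finset.Icc (-(M : ℤ) - 1) ((M : ℤ) + 1),
      Polynomial.C (p.constDn D (n + k)) * p.R M n k * p.PD D (n + k) = 0 := by
  have hp : p.Nondeg := h.base
  rcases lt_or_ge n 0 with hn | hn
  · exact Finset.sum_eq_zero fun k _ => by rw [R_eq_zero h (Or.inl hn), mul_zero, zero_mul]
  obtain ⟨κ, hκ, hconst⟩ := exists_constDn_eq hD hD1 h
  refine eq_of_eval_eta_eq hp h.point fun u hu hphi => ?_
  obtain ⟨w, hw⟩ := det_detMatrix (p := p) D u
  have hterm : ∀ k ∈ Finset.Icc (-(M : ℤ) - 1) ((M : ℤ) + 1),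
      (Polynomial.C (p.constDn D (n + k)) * p.R M n k * p.PD D (n + k)).eval ((p.shift M).eta u)
      = (p.phi (M + 1) u)⁻¹ * ∑ i, w i * (p.cR (M + 1) n k u
        * (if n + k < 0 then 0 else p.cP (n + k).toNat (p.adv (i : ℕ) u))) := by
    intro k hk
    rw [Finset.mem_Icc] at hk
    rcases lt_or_ge (n + k) 0 with hneg | hpos
    · simp [R_eq_zero h (Or.inr hneg), hneg]
    · obtain ⟨m, hm⟩ := Int.eq_ofNat_of_zero_le hpos
      have hR := (isR_iff hp h.point n k _).2 rfl u hu
      have hP := (isPD_iff hp h.point D m _).2 rfl u hu hphi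
      have hc : p.constDn D (m : ℤ) ≠ 0 := by
        rw [hconst]
        refine mul_ne_zero hκ (Finset.prod_ne_zero_iff.2 fun j _ =>
          sub_ne_zero.2 (h.energy_ne m (abs_le.2 ⟨by omega, by omega⟩) j))
      change _ = (p.constDn D m)⁻¹ * (p.phi (M + 1) u)⁻¹ * (p.detMatrix D m u).det at hP
      have hneg : ¬ ((m : ℤ) < 0) := by omega
      rw [hm, eval_mul, eval_mul, eval_C, hR, hP, hw]
      simp only [hneg, if_false, Int.toNat_natCast]
      -- The factor C_{D,n+k} cancels the normalization of P_{D,n+k}, leaving φ⁻¹ and the weights as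
      -- the same for every k.
      rw [show ∀ x y z s : K, x * y * (x⁻¹ * z * s) = x * x⁻¹ * (z * (y * s)) from
        fun x y z s => by ring, mul_inv_cancel₀ hc, one_mul, Finset.mul_sum]
      congr 1
      exact Finset.sum_congr rfl fun i _ => by ring
  rw [eval_finsetSum, Finset.sum_congr rfl hterm, ← Finset.mul_sum, Finset.sum_comm, eval_zero]
  simp only [← Finset.mul_sum]
  rw [Finset.sum_eq_zero, mul_zero]
  intro i _
  rw [sum_cR_mul_cP h hn hu (Nat.lt_succ_iff.1 i.2), mul_zero]

theorem degree_R_le [CharZero K] {D : Fin M → ℕ} {n : ℤ} (h : p.DenomsNeZero D n) {k : ℤ}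
    (hk : |k| ≤ M + 1) : (p.R M n k).degree ≤ ((M + 1 - k.natAbs : ℕ) : WithBot ℕ) := by
  rcases lt_or_ge (n + k) 0 with hneg | hpos
  · simp [R_eq_zero h (Or.inr hneg)]
  · exact degree_le_of_natDegree_le (natDegree_le_of_isR h.base hk
      ((isR_iff h.base h.point n k _).2 rfl) hpos).1

/-- The coefficient of degree M+1-|k| is `symbolCoeff` times a product of A_l (upward) or C_l
(downward). The A_l involved are nonzero by the denominator conditions, so only the C_l need an
assumption. -/
theorem degree_R_eq [CharZero K] {D : Fin M → ℕ} {n : ℤ} (h : p.DenomsNeZero D n) {k : ℤ}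
    (hk : |k| ≤ M + 1) (hn : 0 ≤ n) (hnk : 0 ≤ n + k)
    (hC : ∀ m : ℤ, n + k < m → m ≤ n → p.C m ≠ 0) :
    (p.R M n k).degree = ((M + 1 - k.natAbs : ℕ) : WithBot ℕ) := by
  refine le_antisymm (degree_R_le h hk) (le_degree_of_ne_zero ?_)
  rw [(natDegree_le_of_isR h.base hk ((isR_iff h.base h.point n k _).2 rfl) hnk).2]
  rw [abs_le] at hk
  refine mul_ne_zero (symbolCoeff_ne_zero h.base (by omega)) (mul_ne_zero
    (Finset.prod_ne_zero_iff.2 fun l hl => ?_) (Finset.prod_ne_zero_iff.2 fun l hl => ?_))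
  · rw [Finset.mem_Ico] at hl
    obtain ⟨m, rfl⟩ := Int.eq_ofNat_of_zero_le (hn.trans hl.1)
    obtain ⟨ha, hb, hc⟩ := h.racah (m + 1) (by push_cast; omega)
    exact A_ne_zero ha hb hc (h.recur m (by omega))
  · rw [Finset.mem_Ioc] at hl
    exact hC l hl.1 hl.2

end Params

end MultiRacah

theorem theorem1 {K : Type*} [Field K] [CharZero K] (p : MultiRacah.Params K)
    {M : ℕ} (D : Fin M → ℕ) (hD : StrictMono D) (hD1 : ∀ j, 1 ≤ D j)
    (n : ℤ) (h : p.DenomsNeZero D n) :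
    -- the multi-indexed polynomials which occur are well defined
    (∀ m : ℕ, |(m : ℤ) - n| ≤ M + 1 → ∀ Q : Polynomial K, p.IsPD D m Q ↔ Q = p.PD D m) ∧
    -- the coefficients are polynomials in the sinusoidal coordinate
    (∀ k : ℤ, |k| ≤ M + 1 → ∀ Q : Polynomial K, p.IsR M n k Q ↔ Q = p.R M n k) ∧
    -- of degree at most `M + 1 - |k|`
    (∀ k : ℤ, |k| ≤ M + 1 → (p.R M n k).degree ≤ ((M + 1 - k.natAbs : ℕ) : WithBot ℕ)) ∧
    -- with equality for `n, n + k ≥ 0` unless one of `C_{n+k+1}, …, C_n` vanishes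
    (∀ k : ℤ, |k| ≤ M + 1 → 0 ≤ n → 0 ≤ n + k → (∀ m : ℤ, n + k < m → m ≤ n → p.C m ≠ 0) →
      (p.R M n k).degree = ((M + 1 - k.natAbs : ℕ) : WithBot ℕ)) ∧
    -- the recurrence relations, in both forms
    (∑ k ∈ Finset.Icc (-(M : ℤ) - 1) ((M : ℤ) + 1),
      Polynomial.C (p.constDn D (n + k)) * p.R M n k * p.PD D (n + k) = 0) ∧
    (∑ k ∈ Finset.Icc (-(M : ℤ) - 1) ((M : ℤ) + 1),
      Polynomial.C (∏ j : Fin M,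
        (p.energy (n + k) - p.venergy (D j)) / (p.energy n - p.venergy (D j)))
        * p.R M n k * p.PD D (n + k) = 0) := by
  have hsum := MultiRacah.Params.sum_constDn_mul_R_mul_PD hD hD1 h
  refine ⟨fun m _ Q => MultiRacah.Params.isPD_iff h.base h.point D m Q,
    fun k _ Q => MultiRacah.Params.isR_iff h.base h.point n k Q,
    fun k hk => MultiRacah.Params.degree_R_le h hk,
    fun k hk hn hnk hC => MultiRacah.Params.degree_R_eq h hk hn hnk hC, hsum, ?_⟩
  rcases lt_or_ge n 0 with hn | hn
  · exact Finset.sum_eq_zero fun k _ => by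
      rw [MultiRacah.Params.R_eq_zero h (Or.inl hn), mul_zero, zero_mul]
  obtain ⟨κ, hκ, hconst⟩ := MultiRacah.Params.exists_constDn_eq hD hD1 h
  -- The common factor κ cancels in the quotient, so the second relation is the first multiplied by
  -- C_{D,n}⁻¹.
  have hprod : ∀ k : ℤ, ∏ j : Fin M,
      (p.energy (n + k) - p.venergy (D j)) / (p.energy n - p.venergy (D j))
      = (p.constDn D n)⁻¹ * p.constDn D (n + k) := fun k => by
    rw [hconst, hconst, Finset.prod_div_distrib]
    field_simp
  simp only [hprod, map_mul, mul_assoc, ← Finset.mul_sum] at hsum ⊢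
  rw [hsum, mul_zero]
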